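/- Let $d\ge 1$ and let $\Omega\subseteq\mathbb{R}^d$ be an open, bounded, connected, non-empty set with Lipschitz boundary. Let $J:L^1(\Omega)\to[0,\infty]$ be proper, convex and lower semicontinuous with respect to strong convergence in $L^1(\Omega)$, and suppose that there are constants $C_1,C_2>0$ with $C_1|Du|(\Omega)\le J(u)\le C_2|Du|(\Omega)$ for all $u\in BV(\Omega)$. For $\lambda_1,\lambda_2>0$, a measurable $f$ and $u\in L^1(\Omega)$ put $$\Phi^{\lambda_1,\lambda_2}(u,f)=\inf_{v\in L^1(\Omega)}\ \lambda_1\|v\|_{L^1(\Omega)}+\frac{\lambda_2}{2}\|f-u-v\|_{L^2(\Omega)}^2,$$ where $\|g\|_{L^2(\Omega)}=\infty$ if $g\notin L^2(\Omega)$, and consider the problem $$\min_{u\in BV(\Omega),\ v\in L^1(\Omega)}\ J(u)+\lambda_1\|v\|_{L^1(\Omega)}+\frac{\lambda_2}{2}\|f-u-v\|_{L^2(\Omega)}^2.\qquad(P_{\lambda_1,\lambda_2})$$ We say that $u\in BV(\Omega)$ is a minimiser of $(P_{\lambda_1,\lambda_2})$ if $(u,v)$ is a minimising pair for some $v\in L^1(\Omega)$.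 Weak$^*$ convergence $u_n\to u$ in $BV(\Omega)$ means that $u_n\to u$ in $L^1(\Omega)$ and $\int_\Omega\varphi\,dDu_n\to\int_\Omega\varphi\,dDu$ for every $\varphi\in C_0(\Omega)$. (i) Let $f\in L^1(\Omega)$, let $\lambda_1>0$ be fixed, and let $\lambda_2^{(n)}>0$ with $\lambda_2^{(n)}\to\infty$. Let $u_n\in BV(\Omega)$ be a minimiser of $(P_{\lambda_1,\lambda_2^{(n)}})$ for each $n\in\mathbb{N}$. Then every subsequence of $(u_n)$ has a further subsequence that converges weakly$^*$ in $BV(\Omega)$ to a minimiser of $$\min_{u\in BV(\Omega)}\ J(u)+\lambda_1\|f-u\|_{L^1(\Omega)}.$$ If moreover this problem has a unique minimiser $u^*$, then $u_n\to u^*$ weakly$^*$ in $BV(\Omega)$ and $$J(u_n)+\Phi^{\lambda_1,\lambda_2^{(n)}}(u_n,f)\to J(u^*)+\lambda_1\|f-u^*\|_{L^1(\Omega)}.$$ (ii) Let $f\in L^2(\Omega)$, let $\lambda_2>0$ be fixed, and let $\lambda_1^{(n)}>0$ with $\lambda_1^{(n)}\to\infty$. Let $u_n\in BV(\Omega)$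 be a minimiser of $(P_{\lambda_1^{(n)},\lambda_2})$ for each $n\in\mathbb{N}$. Then the problem $$\min_{u\in BV(\Omega)}\ J(u)+\frac{\lambda_2}{2}\|f-u\|_{L^2(\Omega)}^2$$ has a unique minimiser $u^*$, $u_n\to u^*$ weakly$^*$ in $BV(\Omega)$, and $$J(u_n)+\Phi^{\lambda_1^{(n)},\lambda_2}(u_n,f)\to J(u^*)+\frac{\lambda_2}{2}\|f-u^*\|_{L^2(\Omega)}^2.$$ -/

import Mathlib

open Set Filter Topology MeasureTheory
open scoped NNReal ENNReal InnerProductSpace ZeroAtInfty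

noncomputable section

namespace MixedNoise

/-- The ambient space `ℝ^d` with its Euclidean norm. -/
abbrev Space (d : ℕ) : Type := EuclideanSpace ℝ (Fin d)

variable {d : ℕ}

/-- `Ω` has Lipschitz boundary: near each boundary point, and in suitable rotated coordinates,
`Ω` is the strict epigraph of a Lipschitz function. Here `ν` is the direction of the last
coordinate axis, `y - ⟪ν, y⟫ ν` is the orthogonal projection of `y` onto the hyperplane `ν^⊥`, and
only the values of `g` on this hyperplane matter. -/
def HasLipschitzBoundary (Ω : Set (Space d)) : Prop :=
  ∀ x ∈ frontier Ω, ∃ (r : ℝ) (ν : Space d) (K : ℝ≥0) (g : Space d → ℝ),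
    0 < r ∧ ‖ν‖ = 1 ∧ LipschitzWith K g ∧
      ∀ y ∈ Metric.ball x r, y ∈ Ω ↔ g (y - ⟪ν, y⟫_ℝ • ν) < ⟪ν, y⟫_ℝ

/-- A bounded Lipschitz domain: open, bounded, connected (and non-empty), Lipschitz boundary. -/
structure IsBoundedLipschitzDomain (Ω : Set (Space d)) : Prop where
  isOpen : IsOpen Ω
  isBounded : Bornology.IsBounded Ω
  isConnected : IsConnected Ω
  lipschitz : HasLipschitzBoundary Ω

/-- `L¹(Ω)` with respect to Lebesgue measure. -/
abbrev L1 (Ω : Set (Space d)) : Type := Lp ℝ 1 ((volume : Measure (Space d)).restrict Ω)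

/-- The `ℝ^d`-valued Borel measure `m` on `Ω` is finite and is the distributional derivative `Du`:
`∫_Ω u ∇φ dx = - ∫_Ω φ dm` for every test function `φ ∈ C_c^∞(Ω)`. -/
def IsDeriv (Ω : Set (Space d)) (u : L1 Ω) (m : VectorMeasure Ω (Space d)) : Prop :=
  IsFiniteMeasure m.variation ∧
    ∀ φ : Space d → ℝ, ContDiff ℝ (⊤ : ℕ∞) φ → HasCompactSupport φ → tsupport φ ⊆ Ω →
      ∫ x in Ω, u x • gradient φ x =
        - m.integral (fun x : Ω => φ x) (ContinuousLinearMap.lsmul ℝ ℝ)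

/-- `BV(Ω)`: the functions in `L¹(Ω)` whose distributional derivative is a finite measure. -/
def BV (Ω : Set (Space d)) : Set (L1 Ω) :=
  {u | ∃ m : VectorMeasure Ω (Space d), IsDeriv Ω u m}

/-- `|Du|(Ω)`, the total mass of the variation measure of `Du`. For open `Ω` there is at most one
measure `m` representing `Du`; the value is `∞` if there is none. -/
def totalVar (Ω : Set (Space d)) (u : L1 Ω) : ℝ≥0∞ :=
  ⨅ (m : VectorMeasure Ω (Space d)) (_ : IsDeriv Ω u m), m.variation univ

/-- Weak* convergence in `BV(Ω)`: `u n → u` in `L¹(Ω)`, and `D(u n) → Du` weakly* as measures,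
that is, `∫_Ω φ dD(u n) → ∫_Ω φ dDu` for each `φ ∈ C₀(Ω)`. -/
def TendstoWeakStarBV (Ω : Set (Space d)) (u : ℕ → L1 Ω) (u' : L1 Ω) : Prop :=
  Tendsto u atTop (𝓝 u') ∧
    ∃ (m : ℕ → VectorMeasure Ω (Space d)) (m' : VectorMeasure Ω (Space d)),
      (∀ n, IsDeriv Ω (u n) (m n)) ∧ IsDeriv Ω u' m' ∧
      ∀ φ : C₀(Ω, ℝ),
        Tendsto (fun n => (m n).integral (fun x => φ x) (ContinuousLinearMap.lsmul ℝ ℝ)) atTop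
          (𝓝 (m'.integral (fun x => φ x) (ContinuousLinearMap.lsmul ℝ ℝ)))

/-- The general regularisers `J : L¹(Ω) → [0, ∞]`: proper, convex, lower semicontinuous for the
norm topology of `L¹(Ω)`, and comparable to the total variation on `BV(Ω)`. -/
structure IsRegulariser (Ω : Set (Space d)) (J : L1 Ω → ℝ≥0∞) : Prop where
  proper : ∃ u, J u ≠ ∞
  convex : ConvexOn ℝ≥0 univ J
  lsc : LowerSemicontinuous J
  comparable : ∃ C₁ C₂ : ℝ≥0, 0 < C₁ ∧ 0 < C₂ ∧
    ∀ u ∈ BV Ω, C₁ * totalVar Ω u ≤ J u ∧ J u ≤ C₂ * totalVar Ω u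

/-- `‖g‖_{L^p(Ω)} ∈ [0, ∞]`, with the value `∞` if `g` is not in `L^p(Ω)`. -/
def normOn (Ω : Set (Space d)) (p : ℝ≥0∞) (g : Space d → ℝ) : ℝ≥0∞ :=
  eLpNorm g p ((volume : Measure (Space d)).restrict Ω)

/-- `λ₁ ‖v‖_{L¹} + (λ₂ / 2) ‖f - u - v‖²_{L²}`. -/
def splitFidelity (Ω : Set (Space d)) (lam₁ lam₂ : ℝ≥0) (f : Space d → ℝ) (u v : L1 Ω) : ℝ≥0∞ :=
  lam₁ * normOn Ω 1 v + lam₂ / 2 * normOn Ω 2 (fun x => f x - u x - v x) ^ 2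

/-- The infimal convolution fidelity `Φ^{λ₁,λ₂}(u, f)`. -/
def icFidelity (Ω : Set (Space d)) (lam₁ lam₂ : ℝ≥0) (f : Space d → ℝ) (u : L1 Ω) : ℝ≥0∞ :=
  ⨅ v : L1 Ω, splitFidelity Ω lam₁ lam₂ f u v

/-- `(u, v)` minimises `J(u) + λ₁ ‖v‖_{L¹} + (λ₂ / 2) ‖f - u - v‖²_{L²}` over
`BV(Ω) × L¹(Ω)`. -/
def IsOptimalPair (Ω : Set (Space d)) (J : L1 Ω → ℝ≥0∞) (lam₁ lam₂ : ℝ≥0) (f : Space d → ℝ)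
    (u v : L1 Ω) : Prop :=
  u ∈ BV Ω ∧ ∀ w ∈ BV Ω, ∀ z : L1 Ω,
    J u + splitFidelity Ω lam₁ lam₂ f u v ≤ J w + splitFidelity Ω lam₁ lam₂ f w z

/-- `J(u) + λ ‖f - u‖_{L¹}`. -/
def energyL1 (Ω : Set (Space d)) (J : L1 Ω → ℝ≥0∞) (lam : ℝ≥0) (f : Space d → ℝ) (u : L1 Ω) :
    ℝ≥0∞ :=
  J u + lam * normOn Ω 1 (fun x => f x - u x)

/-- `J(u) + (λ / 2) ‖f - u‖²_{L²}`. -/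
def energyL2 (Ω : Set (Space d)) (J : L1 Ω → ℝ≥0∞) (lam : ℝ≥0) (f : Space d → ℝ) (u : L1 Ω) :
    ℝ≥0∞ :=
  J u + lam / 2 * normOn Ω 2 (fun x => f x - u x) ^ 2

/-- `u` minimises the energy `E` over `BV(Ω)`. -/
def IsMinimiserBV (Ω : Set (Space d)) (E : L1 Ω → ℝ≥0∞) (u : L1 Ω) : Prop :=
  u ∈ BV Ω ∧ ∀ w ∈ BV Ω, E u ≤ E w

end MixedNoise

end

open MixedNoise

/-!
The optimal values of the approximating problems stay below the limit energy of every competitor: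
for `λ₂ → ∞` the competitor `w` is completed by `v = f - w`, for `λ₁ → ∞` by `v = 0`. These bounds
control `J (u n)`, hence the total variation of `u n`, and the `L¹` norm of `u n`; they also force
the residuals `f - u n - v n` (for `λ₂ → ∞`) or the functions `v n` (for `λ₁ → ∞`) to `0` in `L¹`.
Along a subsequence with `u n → u'` in `L¹`, lower semicontinuity of `J` and of the two norms bounds
the limit energy of `u'` by the optimal values, so `u'` is a minimiser and the values converge.
This scheme is `ApproximatesEnergy`. Full convergence follows from uniqueness of the limit, which
for the `L²` energy comes from the parallelogram identity (`eq_of_isMinimiserBV_energyL2`).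

Three facts about `BV` carry the argument.

* Bounded sets are relatively compact in `L¹` (`exists_subseq_tendsto_of_bounded`). No extension
  operator is used. Near each point of `closure Ω` there is a ball of short displacements that keep
  the nearby part of `Ω` inside `Ω`, so that averaging over these displacements changes `u` in `L¹`
  there by at most the displacement length times `|Du|(Ω)` (`lintegral_enorm_translate_sub_le`),
  while the averages are equicontinuous.
* `L¹` limits of functions with uniformly bounded total variation are in `BV`
  (`mem_BV_of_tendsto`), by the Riesz–Markov–Kakutani theorem applied to positive functionals that
  are limits along an ultrafilter.
* For such sequences the derivatives also converge weakly* (`tendstoWeakStarBV_of_tendsto`), because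
  test functions are dense in `C₀(Ω)`.
-/

open Set Filter Topology MeasureTheory
open scoped NNReal ENNReal InnerProductSpace ZeroAtInfty

noncomputable section

namespace MixedNoise

/-! ### Vector measures with a fixed direction and bounded positive functionals -/

section VectorMeasures

variable {X V : Type*} [MeasurableSpace X] [NormedAddCommGroup V] [NormedSpace ℝ V]

/-- The vector measure `s ↦ μ(s) • v`. -/
def directedMeasure (μ : Measure X) [IsFiniteMeasure μ] (v : V) : VectorMeasure X V :=
  μ.toSignedMeasure.mapRange (ContinuousLinearMap.toSpanSingleton ℝ v).toLinearMap.toAddMonoidHom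
    (ContinuousLinearMap.toSpanSingleton ℝ v).continuous

theorem directedMeasure_apply (μ : Measure X) [IsFiniteMeasure μ] (v : V) {s : Set X}
    (hs : MeasurableSet s) : directedMeasure μ v s = μ.real s • v := by
  simp [directedMeasure, Measure.toSignedMeasure_apply_measurable hs]

theorem variation_directedMeasure_le (μ : Measure X) [IsFiniteMeasure μ] (v : V) :
    (directedMeasure μ v).variation ≤ ‖v‖ₑ • μ := by
  refine VectorMeasure.variation_le_of_forall_enorm_le fun s hs ↦ ?_
  rw [directedMeasure_apply μ v hs, enorm_smul, Measure.smul_apply, smul_eq_mul, mul_comm]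
  gcongr
  rw [Real.enorm_of_nonneg measureReal_nonneg, measureReal_def,
    ENNReal.ofReal_toReal (by finiteness)]

theorem integrable_directedMeasure {μ : Measure X} [IsFiniteMeasure μ] (v : V) {f : X → ℝ}
    (hf : Integrable f μ) : (directedMeasure μ v).Integrable f :=
  Integrable.of_measure_le_smul (by finiteness) (variation_directedMeasure_le μ v) hf

theorem integral_directedMeasure [CompleteSpace V] {μ : Measure X} [IsFiniteMeasure μ] (v : V)
    {f : X → ℝ} (hf : Integrable f μ) :
    (directedMeasure μ v).integral f (ContinuousLinearMap.lsmul ℝ ℝ) = (∫ x, f x ∂μ) • v := by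
  have hdom : DominatedFinMeasAdditive μ
      ((directedMeasure μ v).transpose (ContinuousLinearMap.lsmul ℝ ℝ)) ‖v‖ := by
    refine ⟨fun s t hs ht _ _ hd ↦ VectorMeasure.of_union hd hs ht, fun s hs hsf ↦ ?_⟩
    refine ContinuousLinearMap.opNorm_le_bound _ (by positivity) fun x ↦ ?_
    have : (directedMeasure μ v).transpose (ContinuousLinearMap.lsmul ℝ ℝ) s x
        = x • (μ.real s • v) := by
      rw [← directedMeasure_apply μ v hs]; rfl
    rw [this, norm_smul, norm_smul, Real.norm_of_nonneg measureReal_nonneg]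
    exact le_of_eq (by ring)
  have key : ∀ g : X → ℝ, Integrable g μ →
      setToFun μ ((directedMeasure μ v).transpose (ContinuousLinearMap.lsmul ℝ ℝ)) hdom g
        = (∫ x, g x ∂μ) • v := by
    intro g hg
    refine Integrable.induction (fun g ↦ setToFun μ
      ((directedMeasure μ v).transpose (ContinuousLinearMap.lsmul ℝ ℝ)) hdom g
        = (∫ x, g x ∂μ) • v) ?_ ?_ ?_ ?_ hg
    · intro c s hs hμs
      rw [setToFun_indicator_const _ hs hμs.ne, integral_indicator_const _ hs]
      change c • (directedMeasure μ v s) = _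
      rw [directedMeasure_apply μ v hs, smul_smul, smul_eq_mul, mul_comm]
    · intro g h _ hg hh ihg ihh
      rw [setToFun_add _ hg hh, ihg, ihh]
      change _ = (∫ x, g x + h x ∂μ) • v
      rw [integral_add hg hh, add_smul]
    · exact isClosed_eq (continuous_setToFun _) (continuous_integral.smul continuous_const)
    · intro g h hgh _ ih
      rw [← setToFun_congr_ae _ hgh, ih, integral_congr_ae hgh]
  rw [VectorMeasure.integral_eq_setToFun, ← key f hf]
  exact (setToFun_congr_measure_of_integrable ‖v‖ₑ (by finiteness)
    (variation_directedMeasure_le μ v) hdom _ f hf).symm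

end VectorMeasures

section Riesz

open CompactlySupported

variable {X : Type*} [TopologicalSpace X] [T2Space X] [LocallyCompactSpace X] [MeasurableSpace X]
  [BorelSpace X]

/-- A positive linear functional on `C_c(X)` that is bounded for the sup norm is represented by a
finite measure. -/
theorem exists_finiteMeasure_of_bounded (Λ : C_c(X, ℝ) →ₗ[ℝ] ℝ) (C : ℝ)
    (hpos : ∀ φ : C_c(X, ℝ), (∀ x, 0 ≤ φ x) → 0 ≤ Λ φ)
    (hbd : ∀ φ : C_c(X, ℝ), (∀ x, |φ x| ≤ 1) → Λ φ ≤ C) :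
    ∃ μ : Measure X, IsFiniteMeasure μ ∧ ∀ φ : C_c(X, ℝ), ∫ x, φ x ∂μ = Λ φ := by
  let Λ' : C_c(X, ℝ) →ₚ[ℝ] ℝ := PositiveLinearMap.mk₀ Λ fun φ hφ ↦ hpos φ fun x ↦ hφ x
  refine ⟨RealRMK.rieszMeasure Λ', ⟨?_⟩, fun φ ↦ RealRMK.integral_rieszMeasure Λ' φ⟩
  refine lt_of_le_of_lt ?_ (ENNReal.ofReal_lt_top (r := C))
  rw [isOpen_univ.measure_eq_iSup_isCompact]
  refine iSup₂_le fun K _ ↦ iSup_le fun hK ↦ ?_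
  obtain ⟨f, hf1, hf2, hf3⟩ :=
    exists_continuousMap_one_of_isCompact_subset_isOpen hK isOpen_univ (subset_univ K)
  let φ : C_c(X, ℝ) := ⟨f, hasCompactSupport_def.mpr hf2⟩
  have h0 : ∀ x, 0 ≤ φ x := fun x ↦ (hf3.2 x).1
  have h1 : ∀ x, φ x ≤ 1 := fun x ↦ (hf3.2 x).2
  refine (RealRMK.rieszMeasure_le_of_eq_one Λ' (f := φ) h0 hK fun x hx ↦ hf1 hx).trans ?_
  exact ENNReal.ofReal_le_ofReal (hbd φ fun x ↦ by rw [abs_of_nonneg (h0 x)]; exact h1 x)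

end Riesz

/-! ### Closedness of bounded sets of `BV` in `L¹` -/

variable {d : ℕ} {Ω : Set (Space d)}

/-- Pointwise limits along an ultrafilter of pointwise bounded linear functionals. -/
theorem exists_linearMap_tendsto_ultrafilter {ι V : Type*} [AddCommGroup V] [Module ℝ V]
    (U : Ultrafilter ι) (A : ι → V →ₗ[ℝ] ℝ) (hA : ∀ v, ∃ B, ∀ i, |A i v| ≤ B) :
    ∃ L : V →ₗ[ℝ] ℝ, ∀ v, Tendsto (fun i ↦ A i v) U (𝓝 (L v)) := by
  have h : ∀ v, ∃ a, Tendsto (fun i ↦ A i v) U (𝓝 a) := fun v ↦ by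
    obtain ⟨B, hB⟩ := hA v
    obtain ⟨a, -, ha⟩ := (isCompact_Icc (a := -B) (b := B)).ultrafilter_le_nhds
      (U.map fun i ↦ A i v) (by
        simp only [le_principal_iff, Ultrafilter.mem_coe, Ultrafilter.mem_map]
        exact Filter.univ_mem' fun i ↦ abs_le.1 (hB i))
    exact ⟨a, ha⟩
  choose L hL using h
  refine ⟨⟨⟨L, fun v w ↦ tendsto_nhds_unique (hL _) ?_⟩, fun c v ↦
    tendsto_nhds_unique (hL _) ?_⟩, hL⟩
  · simpa using (hL v).add (hL w)
  · simpa using (hL v).const_mul c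

theorem continuous_gradient {φ : Space d → ℝ} (h : ContDiff ℝ (⊤ : ℕ∞) φ) :
    Continuous (gradient φ) :=
  (InnerProductSpace.toDual ℝ (Space d)).symm.continuous.comp (h.continuous_fderiv (by simp))

theorem exists_norm_gradient_le {φ : Space d → ℝ} (h : ContDiff ℝ (⊤ : ℕ∞) φ)
    (hc : HasCompactSupport φ) : ∃ C, ∀ x, ‖gradient φ x‖ ≤ C := by
  refine (continuous_gradient h).bounded_above_of_compact_support ?_
  exact (hc.fderiv (𝕜 := ℝ)).comp_left (g := (InnerProductSpace.toDual ℝ (Space d)).symm) (by simp)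

theorem continuous_integral_smul_gradient {φ : Space d → ℝ} (h : ContDiff ℝ (⊤ : ℕ∞) φ)
    (hc : HasCompactSupport φ) :
    Continuous fun u : L1 Ω ↦ ∫ x in Ω, u x • gradient φ x := by
  obtain ⟨C, hC⟩ := exists_norm_gradient_le h hc
  have hint : ∀ u : L1 Ω, Integrable (fun x ↦ u x • gradient φ x) (volume.restrict Ω) := fun u ↦
    (L1.integrable_coeFn u).smul_bdd C (continuous_gradient h).aestronglyMeasurable
      (.of_forall hC)
  refine (LipschitzWith.of_dist_le_mul (K := C.toNNReal) fun u w ↦ ?_).continuous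
  rw [dist_eq_norm, ← integral_sub (hint u) (hint w), dist_eq_norm, L1.norm_eq_integral_norm,
    ← integral_const_mul]
  refine norm_integral_le_of_norm_le ((L1.integrable_coeFn _).norm.const_mul _) ?_
  filter_upwards [Lp.coeFn_sub u w] with x hx
  rw [← sub_smul, norm_smul, hx, Pi.sub_apply, mul_comm]
  gcongr
  exact (hC x).trans (Real.le_coe_toNNReal C)

theorem hasCompactSupport_restrict {φ : Space d → ℝ} (hc : HasCompactSupport φ)
    (hs : tsupport φ ⊆ Ω) : HasCompactSupport fun x : Ω ↦ φ x := by
  have hK : IsCompact ((↑) ⁻¹' tsupport φ : Set Ω) :=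
    IsInducing.subtypeVal.isCompact_preimage' hc (by simpa using hs)
  refine HasCompactSupport.intro' hK ((isClosed_tsupport φ).preimage continuous_subtype_val) ?_
  exact fun x hx ↦ image_eq_zero_of_notMem_tsupport hx

open CompactlySupported in
theorem exists_vectorMeasure_of_components {X : Type*} [TopologicalSpace X] [MeasurableSpace X]
    [OpensMeasurableSpace X] (μ : Fin d → Measure X) [∀ k, IsFiniteMeasure (μ k)]
    (μ₀ : Measure X) [IsFiniteMeasure μ₀] :
    ∃ M : VectorMeasure X (Space d), IsFiniteMeasure M.variation ∧ ∀ ψ : C_c(X, ℝ),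
      M.integral ψ (ContinuousLinearMap.lsmul ℝ ℝ)
        = ∑ k, (∫ x, ψ x ∂μ k - ∫ x, ψ x ∂μ₀) • EuclideanSpace.single k (1 : ℝ) := by
  let e : Fin d → Space d := fun k ↦ EuclideanSpace.single k 1
  refine ⟨∑ k, (directedMeasure (μ k) (e k) - directedMeasure μ₀ (e k)), ⟨?_⟩, fun ψ ↦ ?_⟩
  · refine lt_of_le_of_lt ((VectorMeasure.variation_finsetSum_le _ _).trans
      (Finset.sum_le_sum fun k _ ↦ VectorMeasure.variation_sub_le.trans
        (add_le_add (variation_directedMeasure_le (μ k) (e k))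
          (variation_directedMeasure_le μ₀ (e k)))) univ) ?_
    simp only [Measure.coe_finsetSum, Finset.sum_apply, Measure.coe_add, Pi.add_apply,
      Measure.smul_apply, smul_eq_mul]
    exact ENNReal.sum_lt_top.2 fun k _ ↦ by finiteness
  · have h1 := fun k ↦ integrable_directedMeasure (e k) (ψ.integrable (μ := μ k))
    have h2 := fun k ↦ integrable_directedMeasure (e k) (ψ.integrable (μ := μ₀))
    rw [VectorMeasure.integral_finsetSum_vectorMeasure fun k _ ↦ (h1 k).sub_vectorMeasure (h2 k)]
    refine Finset.sum_congr rfl fun k _ ↦ ?_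
    rw [VectorMeasure.integral_sub_vectorMeasure (h1 k) (h2 k), sub_smul,
      integral_directedMeasure (e k) ψ.integrable, integral_directedMeasure (e k) ψ.integrable]

open CompactlySupported in
/-- Functions in `L¹(Ω)` that are limits of functions with uniformly bounded total variation have
bounded variation. The positive functionals `φ ↦ ∫ φ d|D(w i)|` and
`φ ↦ ∫ φ d|D(w i)| + ∫ φ dD_k(w i)` have limits along an ultrafilter, which are finite measures
`μ₀` and `μ_k`; the derivative of the limit is `∑ k, (μ_k - μ₀) e_k`. -/
theorem mem_BV_of_tendsto {ι : Type*} {l : Filter ι} [l.NeBot] (hΩ : IsOpen Ω) {w : ι → L1 Ω}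
    {u : L1 Ω} {m : ι → VectorMeasure Ω (Space d)} {C : ℝ} (hm : ∀ i, IsDeriv Ω (w i) (m i))
    (hC : ∀ i, (m i).variation.real univ ≤ C) (hu : Tendsto w l (𝓝 u)) : u ∈ BV Ω := by
  have : LocallyCompactSpace Ω := hΩ.locallyCompactSpace
  have hfin : ∀ i, IsFiniteMeasure (m i).variation := fun i ↦ (hm i).1
  let U := Ultrafilter.of l
  have hU : Tendsto w U (𝓝 u) := hu.mono_left (Ultrafilter.of_le l)
  let I : ι → C_c(Ω, ℝ) →ₗ[ℝ] Space d := fun i ↦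
    { toFun := fun φ ↦ (m i).integral φ (ContinuousLinearMap.lsmul ℝ ℝ)
      map_add' := fun φ ψ ↦ VectorMeasure.integral_add φ.integrable ψ.integrable
      map_smul' := fun c φ ↦ VectorMeasure.integral_smul _ _ _ c }
  let A : ι → C_c(Ω, ℝ) →ₗ[ℝ] ℝ := fun i ↦
    { toFun := fun φ ↦ ∫ x, φ x ∂(m i).variation
      map_add' := fun φ ψ ↦ integral_add φ.integrable ψ.integrable
      map_smul' := fun c φ ↦ integral_const_mul c _ }
  let P : Fin d → ι → C_c(Ω, ℝ) →ₗ[ℝ] ℝ := fun k i ↦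
    A i + (EuclideanSpace.proj k : Space d →L[ℝ] ℝ).toLinearMap ∘ₗ I i
  have hIA : ∀ k i φ, |I i φ k| ≤ ∫ x, |φ x| ∂(m i).variation := fun k i φ ↦ by
    refine (PiLp.norm_apply_le (I i φ) k).trans ?_
    refine VectorMeasure.norm_integral_le_integral_norm.trans ?_
    refine mul_le_of_le_one_left (by positivity) ?_
    exact ContinuousLinearMap.opNorm_lsmul_le
  have habs : ∀ i (φ : C_c(Ω, ℝ)) B, (∀ x, |φ x| ≤ B) → 0 ≤ B →
      ∫ x, |φ x| ∂(m i).variation ≤ C * B := fun i φ B hB hB0 ↦ by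
    refine (integral_mono φ.integrable.norm (integrable_const B) hB).trans ?_
    rw [integral_const, smul_eq_mul]
    gcongr
    exact hC i
  have hA : ∀ i (φ : C_c(Ω, ℝ)), |A i φ| ≤ ∫ x, |φ x| ∂(m i).variation := fun i φ ↦
    abs_integral_le_integral_abs
  have hP : ∀ k i (φ : C_c(Ω, ℝ)), |P k i φ| ≤ 2 * ∫ x, |φ x| ∂(m i).variation := fun k i φ ↦ by
    have := abs_add_le (A i φ) (I i φ k)
    have h1 := hA i φ
    have h2 := hIA k i φ
    change |A i φ + I i φ k| ≤ _
    linarith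
  have hbd : ∀ φ : C_c(Ω, ℝ), ∃ B, 0 ≤ B ∧ ∀ x, |φ x| ≤ B := fun φ ↦ by
    obtain ⟨B, hB⟩ := φ.continuous.bounded_above_of_compact_support φ.hasCompactSupport
    exact ⟨max B 0, le_max_right _ _, fun x ↦ (hB x).trans (le_max_left _ _)⟩
  obtain ⟨L₀, hL₀⟩ := exists_linearMap_tendsto_ultrafilter U A fun φ ↦ by
    obtain ⟨B, hB0, hB⟩ := hbd φ
    exact ⟨C * B, fun i ↦ (hA i φ).trans (habs i φ B hB hB0)⟩
  have hLP : ∀ k, ∃ L : C_c(Ω, ℝ) →ₗ[ℝ] ℝ, ∀ φ, Tendsto (fun i ↦ P k i φ) U (𝓝 (L φ)) :=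
    fun k ↦ exists_linearMap_tendsto_ultrafilter U (P k) fun φ ↦ by
      obtain ⟨B, hB0, hB⟩ := hbd φ
      refine ⟨2 * (C * B), fun i ↦ (hP k i φ).trans ?_⟩
      have := habs i φ B hB hB0
      linarith
  choose L hL using hLP
  obtain ⟨μ₀, hμ₀, hμ₀L⟩ := exists_finiteMeasure_of_bounded L₀ (C * 1)
    (fun φ hφ ↦ ge_of_tendsto' (hL₀ φ) fun i ↦ integral_nonneg hφ)
    (fun φ hφ ↦ le_of_tendsto' (hL₀ φ) fun i ↦
      (le_abs_self _).trans ((hA i φ).trans (habs i φ 1 hφ zero_le_one)))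
  have hμ : ∀ k, ∃ μ : Measure Ω, IsFiniteMeasure μ ∧ ∀ φ : C_c(Ω, ℝ), ∫ x, φ x ∂μ = L k φ :=
    fun k ↦ exists_finiteMeasure_of_bounded (L k) (2 * (C * 1))
      (fun φ hφ ↦ ge_of_tendsto' (hL k φ) fun i ↦ by
        have h1 := (abs_le.1 (hIA k i φ)).1
        have h2 : ∫ x, |φ x| ∂(m i).variation = A i φ :=
          integral_congr_ae (.of_forall fun x ↦ abs_of_nonneg (hφ x))
        change 0 ≤ A i φ + I i φ k
        linarith)
      (fun φ hφ ↦ le_of_tendsto' (hL k φ) fun i ↦ by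
        have h1 := habs i φ 1 hφ zero_le_one
        have h2 := hP k i φ
        have h3 := le_abs_self (P k i φ)
        linarith)
  choose μ hμf hμL using hμ
  obtain ⟨M, hMf, hM⟩ := exists_vectorMeasure_of_components μ μ₀
  refine ⟨M, hMf, fun φ hφ hφc hφs ↦ ?_⟩
  let ψ : C_c(Ω, ℝ) := ⟨⟨fun x ↦ φ x, hφ.continuous.comp continuous_subtype_val⟩,
    hasCompactSupport_restrict hφc hφs⟩
  have h1 : Tendsto (fun i ↦ I i ψ) U
      (𝓝 (∑ k, (L k ψ - L₀ ψ) • EuclideanSpace.single k (1 : ℝ))) := by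
    have : ∀ i, I i ψ = ∑ k, (P k i ψ - A i ψ) • EuclideanSpace.single k (1 : ℝ) := fun i ↦ by
      have h : ∀ k, P k i ψ - A i ψ = I i ψ k := fun k ↦ add_sub_cancel_left _ _
      simp_rw [h]
      ext j
      simp [Finset.sum_apply, Pi.single_apply]
    simp_rw [this]
    exact tendsto_finsetSum _ fun k _ ↦ ((hL k ψ).sub (hL₀ ψ)).smul_const _
  have h2 := ((continuous_integral_smul_gradient (Ω := Ω) hφ hφc).tendsto u).comp hU
  have h3 : M.integral (fun x : Ω ↦ φ x) (ContinuousLinearMap.lsmul ℝ ℝ)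
      = ∑ k, (L k ψ - L₀ ψ) • EuclideanSpace.single k (1 : ℝ) := by
    refine (hM ψ).trans (Finset.sum_congr rfl fun k _ ↦ ?_)
    rw [hμL, hμ₀L]
  rw [h3]
  refine tendsto_nhds_unique h2 (h1.neg.congr fun i ↦ ?_)
  exact ((hm i).2 φ hφ hφc hφs).symm

/-! ### Weak* convergence in `BV` -/

open Function in
/-- Test functions are dense in `C₀(Ω)` for the sup norm. The soft threshold of `φ` at height `ε`
has compact support, and its extension by zero is then smoothed without enlarging the support. -/
theorem exists_contDiff_approx_zeroAtInfty (hΩ : IsOpen Ω) (φ : C₀(Ω, ℝ)) {ε : ℝ} (hε : 0 < ε) :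
    ∃ ψ : Space d → ℝ, ContDiff ℝ (⊤ : ℕ∞) ψ ∧ HasCompactSupport ψ ∧ tsupport ψ ⊆ Ω ∧
      ∀ x : Ω, |ψ x - φ x| ≤ 2 * ε := by
  let g : Ω → ℝ := fun x ↦ φ x - max (-ε) (min ε (φ x))
  have hgc : Continuous g := by
    have := φ.continuous
    fun_prop
  have hgφ : ∀ x, |g x - φ x| ≤ ε := fun x ↦ by
    have h1 : g x - φ x = - max (-ε) (min ε (φ x)) := by simp [g]
    rw [h1, abs_neg, abs_le]
    exact ⟨le_max_left _ _, max_le (by linarith) (min_le_left _ _)⟩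
  obtain ⟨K, hK, hKφ⟩ : ∃ K : Set Ω, IsCompact K ∧ ∀ x ∉ K, g x = 0 := by
    have h := φ.zero_at_infty'.eventually (Metric.ball_mem_nhds (0 : ℝ) hε)
    rw [eventually_iff, mem_cocompact] at h
    obtain ⟨K, hK, hKs⟩ := h
    refine ⟨K, hK, fun x hx ↦ ?_⟩
    have h2 : |φ x| < ε := by simpa using hKs hx
    have h3 := abs_lt.1 h2
    simp only [g]
    rw [min_eq_right h3.2.le, max_eq_right h3.1.le, sub_self]
  have hcomp : IsCompact ((↑) '' K : Set (Space d)) := hK.image continuous_subtype_val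
  let G : Space d → ℝ := Subtype.val.extend g 0
  have hGx : ∀ x : Ω, G x = g x := fun x ↦ Subtype.val_injective.extend_apply g 0 x
  have hG0 : ∀ x ∉ ((↑) '' K : Set (Space d)), G x = 0 := fun x hx ↦ by
    by_cases hxΩ : x ∈ Ω
    · rw [show G x = g ⟨x, hxΩ⟩ from hGx ⟨x, hxΩ⟩]
      exact hKφ _ fun h ↦ hx ⟨_, h, rfl⟩
    · exact extend_apply' _ _ _ fun ⟨y, hy⟩ ↦ hxΩ (hy ▸ y.2)
  have hGc : Continuous G := by
    rw [continuous_iff_continuousAt]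
    intro x
    by_cases hxΩ : x ∈ Ω
    · have : ContinuousAt (fun y : Ω ↦ G y) ⟨x, hxΩ⟩ := by
        simp_rw [hGx]; exact hgc.continuousAt
      exact (hΩ.isOpenEmbedding_subtypeVal.continuousAt_iff (x := ⟨x, hxΩ⟩)).1 this
    · have hx : x ∈ ((↑) '' K : Set (Space d))ᶜ := by
        rintro ⟨y, -, rfl⟩; exact hxΩ y.2
      refine (continuousAt_const (y := (0 : ℝ))).congr ?_
      filter_upwards [hcomp.isClosed.isOpen_compl.mem_nhds hx] with y hy
      exact (hG0 y hy).symm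
  obtain ⟨ψ, hψ, hψG, hψs⟩ := hGc.exists_contDiff_approx ⊤ (ε := fun _ ↦ ε) continuous_const
    fun _ ↦ hε
  have hts : tsupport ψ ⊆ ((↑) '' K : Set (Space d)) := by
    refine closure_minimal (fun x hx ↦ ?_) hcomp.isClosed
    by_contra h
    exact hψs hx (hG0 x h)
  refine ⟨ψ, hψ, hcomp.of_isClosed_subset (isClosed_tsupport _) hts,
    hts.trans (by simp), fun x ↦ ?_⟩
  have h1 : |ψ x - G x| < ε := hψG x
  rw [hGx] at h1
  have := abs_sub_le (ψ x) (g x) (φ x)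
  linarith [hgφ x]

theorem norm_integral_le_mul_variation {X : Type*} [MeasurableSpace X]
    {m : VectorMeasure X (Space d)} [IsFiniteMeasure m.variation] {f : X → ℝ} {B : ℝ}
    (hB : 0 ≤ B) (hf : ∀ x, |f x| ≤ B) :
    ‖m.integral f (ContinuousLinearMap.lsmul ℝ ℝ)‖ ≤ B * m.variation.real univ := by
  refine (VectorMeasure.norm_integral_le_of_norm_le_const (.of_forall hf)).trans ?_
  gcongr
  exact mul_le_of_le_one_right hB ContinuousLinearMap.opNorm_lsmul_le

theorem integrable_zeroAtInfty {X : Type*} [TopologicalSpace X] [MeasurableSpace X]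
    [OpensMeasurableSpace X] {μ : Measure X} [IsFiniteMeasure μ] (φ : C₀(X, ℝ)) :
    Integrable φ μ :=
  φ.toBCF.integrable μ

/-- For functions of uniformly bounded total variation, convergence in `L¹(Ω)` implies weak*
convergence. -/
theorem tendstoWeakStarBV_of_tendsto (hΩ : IsOpen Ω) {u : ℕ → L1 Ω} {u' : L1 Ω}
    {m : ℕ → VectorMeasure Ω (Space d)} {C : ℝ} (hm : ∀ n, IsDeriv Ω (u n) (m n))
    (hC : ∀ n, (m n).variation.real univ ≤ C) (hu : Tendsto u atTop (𝓝 u')) :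
    TendstoWeakStarBV Ω u u' := by
  obtain ⟨m', hm'⟩ := mem_BV_of_tendsto hΩ hm hC hu
  refine ⟨hu, m, m', hm, hm', fun φ ↦ ?_⟩
  have hfin : ∀ n, IsFiniteMeasure (m n).variation := fun n ↦ (hm n).1
  have hfin' : IsFiniteMeasure m'.variation := hm'.1
  have hC0 : 0 ≤ C := measureReal_nonneg.trans (hC 0)
  set C' := m'.variation.real univ with hC'
  have hC'0 : 0 ≤ C' := measureReal_nonneg
  rw [Metric.tendsto_atTop]
  intro ε hε
  obtain ⟨δ, hδ, hδε⟩ : ∃ δ > 0, 2 * δ * C + 2 * δ * C' + δ < ε := by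
    refine ⟨ε / (2 * C + 2 * C' + 2), by positivity, ?_⟩
    rw [show 2 * (ε / (2 * C + 2 * C' + 2)) * C + 2 * (ε / (2 * C + 2 * C' + 2)) * C'
      + ε / (2 * C + 2 * C' + 2) = ε * ((2 * C + 2 * C' + 1) / (2 * C + 2 * C' + 2)) by
        field_simp]
    refine mul_lt_of_lt_one_right hε ((div_lt_one (by positivity)).2 (by linarith))
  obtain ⟨ψ, hψ, hψc, hψs, hψφ⟩ := exists_contDiff_approx_zeroAtInfty hΩ φ hδ
  have hlim : Tendsto (fun n ↦ (m n).integral (fun x : Ω ↦ ψ x) (ContinuousLinearMap.lsmul ℝ ℝ))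
      atTop (𝓝 (m'.integral (fun x : Ω ↦ ψ x) (ContinuousLinearMap.lsmul ℝ ℝ))) := by
    have := (((continuous_integral_smul_gradient (Ω := Ω) hψ hψc).tendsto u').comp hu).neg
    rw [hm'.2 ψ hψ hψc hψs, neg_neg] at this
    refine this.congr fun n ↦ ?_
    exact neg_eq_iff_eq_neg.2 ((hm n).2 ψ hψ hψc hψs)
  have hψint : ∀ (μ : Measure Ω) [IsFiniteMeasure μ], Integrable (fun x : Ω ↦ ψ x) μ := fun μ _ ↦
    (hψ.continuous.comp continuous_subtype_val).integrable_of_hasCompactSupport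
      (hasCompactSupport_restrict hψc hψs)
  have hclose : ∀ (μ : VectorMeasure Ω (Space d)) [IsFiniteMeasure μ.variation],
      dist (μ.integral (fun x : Ω ↦ ψ x) (ContinuousLinearMap.lsmul ℝ ℝ))
        (μ.integral (fun x ↦ φ x) (ContinuousLinearMap.lsmul ℝ ℝ))
      ≤ 2 * δ * μ.variation.real univ := fun μ _ ↦ by
    rw [dist_eq_norm, ← VectorMeasure.integral_sub (hψint _) (integrable_zeroAtInfty φ)]
    exact norm_integral_le_mul_variation (by positivity) hψφ
  obtain ⟨N, hN⟩ := Metric.tendsto_atTop.1 hlim δ hδ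
  refine ⟨N, fun n hn ↦ ?_⟩
  have h1 := hclose (m n)
  have h2 := hclose m'
  have h3 := hN n hn
  have h4 : 2 * δ * (m n).variation.real univ ≤ 2 * δ * C := by gcongr; exact hC n
  rw [dist_comm] at h1
  calc _ ≤ _ := dist_triangle4 _ _ _ _
    _ < ε := by linarith

/-! ### The translation estimate in `L¹` -/

theorem integral_mul_le_of_forall_contDiff {A : Set (Space d)} {w : Space d → ℝ}
    (hw : Integrable w) {C : ℝ}
    (h : ∀ φ : Space d → ℝ, ContDiff ℝ (⊤ : ℕ∞) φ → HasCompactSupport φ → tsupport φ ⊆ A →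
      (∀ x, |φ x| ≤ 1) → ∫ x, w x * φ x ≤ C)
    {φ : Space d → ℝ} (hφ : Continuous φ) (hc : HasCompactSupport φ) (hs : tsupport φ ⊆ A)
    (h1 : ∀ x, |φ x| ≤ 1) : ∫ x, w x * φ x ≤ C := by
  have hint : ∀ {ψ : Space d → ℝ} {B : ℝ}, Continuous ψ → (∀ x, |ψ x| ≤ B) →
      Integrable fun x ↦ w x * ψ x := fun hψ hB ↦
    hw.mul_bdd hψ.aestronglyMeasurable (.of_forall hB)
  have key : ∀ ε > 0, ∫ x, w x * φ x ≤ (1 + ε) * C + ε * ∫ x, |w x| := fun ε hε ↦ by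
    obtain ⟨ψ, hψ, hψφ, hψs⟩ := hφ.exists_contDiff_approx ⊤ (ε := fun _ ↦ ε) continuous_const
      fun _ ↦ hε
    replace hψφ : ∀ x, |ψ x - φ x| ≤ ε := fun x ↦ (hψφ x).le
    have hψ1 : ∀ x, |ψ x| ≤ 1 + ε := fun x ↦ by
      have := abs_sub_abs_le_abs_sub (ψ x) (φ x)
      linarith [h1 x, hψφ x]
    have hle := h (fun x ↦ (1 + ε)⁻¹ * ψ x) (contDiff_const.mul hψ) ((hc.mono hψs).mul_left)
      ((closure_mono fun x hx ↦ hψs (right_ne_zero_of_mul hx)).trans hs) fun x ↦ by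
        rw [abs_mul, abs_of_pos (by positivity), inv_mul_le_iff₀ (by positivity), mul_one]
        exact hψ1 x
    have h2 : ∫ x, w x * ψ x ≤ (1 + ε) * C := by
      rw [← inv_mul_le_iff₀ (by positivity), ← integral_const_mul]
      refine le_of_eq_of_le (integral_congr_ae (.of_forall fun x ↦ ?_)) hle
      simp only
      ring
    have h3 : ∫ x, w x * φ x ≤ ∫ x, (w x * ψ x + ε * |w x|) := by
      refine integral_mono (hint hφ h1) ((hint hψ.continuous hψ1).add (hw.abs.const_mul ε))
        fun x ↦ ?_
      have h4 : w x * (φ x - ψ x) ≤ |w x| * ε := by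
        refine (le_abs_self _).trans ?_
        rw [abs_mul, abs_sub_comm]
        gcongr
        exact hψφ x
      simp only
      linarith
    rw [integral_add (hint hψ.continuous hψ1) (hw.abs.const_mul ε), integral_const_mul] at h3
    linarith
  have hlim : Tendsto (fun ε : ℝ ↦ (1 + ε) * C + ε * ∫ x, |w x|) (𝓝[>] 0)
      (𝓝 ((1 + 0) * C + 0 * ∫ x, |w x|)) :=
    (Continuous.tendsto (by fun_prop) 0).mono_left nhdsWithin_le_nhds
  have := ge_of_tendsto hlim (eventually_mem_nhdsWithin.mono key)
  simpa using this

/-- The `L¹` norm on an open set is the supremum of the pairings with test functions bounded by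
`1`. -/
theorem lintegral_enorm_le_of_forall_contDiff {A : Set (Space d)} (hA : IsOpen A)
    {w : Space d → ℝ} (hw : Integrable w) {C : ℝ}
    (h : ∀ φ : Space d → ℝ, ContDiff ℝ (⊤ : ℕ∞) φ → HasCompactSupport φ → tsupport φ ⊆ A →
      (∀ x, |φ x| ≤ 1) → ∫ x, w x * φ x ≤ C) :
    ∫⁻ x in A, ‖w x‖ₑ ≤ ENNReal.ofReal C := by
  have : IsFiniteMeasure (volume.withDensity fun x ↦ ‖w x‖ₑ) :=
    isFiniteMeasure_withDensity hw.hasFiniteIntegral.ne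
  rw [← withDensity_apply _ hA.measurableSet, hA.measure_eq_iSup_isCompact]
  refine iSup₂_le fun K hKA ↦ iSup_le fun hK ↦ ?_
  obtain ⟨χ, hχ1, hχc, hχA, hχ01⟩ : ∃ χ : C(Space d, ℝ), EqOn χ 1 K ∧ HasCompactSupport χ ∧
      tsupport χ ⊆ A ∧ ∀ x, χ x ∈ Icc (0 : ℝ) 1 := by
    obtain ⟨χ, h1, h2, h3⟩ := exists_continuousMap_one_of_isCompact_subset_isOpen hK hA hKA
    exact ⟨χ, h1, h2, h3⟩
  have hχi : Integrable χ := χ.continuous.integrable_of_hasCompactSupport hχc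
  have hχw : Integrable fun x ↦ χ x * |w x| := by
    refine hw.abs.bdd_mul (c := 1) χ.continuous.aestronglyMeasurable (.of_forall fun x ↦ ?_)
    rw [Real.norm_of_nonneg (hχ01 x).1]
    exact (hχ01 x).2
  have key : ∀ ε > 0, ∫ x, χ x * |w x| ≤ C + ε * (∫ x, χ x) + 2 * ε := fun ε hε ↦ by
    obtain ⟨g, -, hgw, hg, hgi⟩ := hw.exists_hasCompactSupport_integral_sub_le hε
    -- a continuous substitute for `χ * sign g`
    let φ : Space d → ℝ := fun x ↦ χ x * (g x / (|g x| + ε))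
    have hpos : ∀ x, 0 < |g x| + ε := fun x ↦ by positivity
    have hφ : Continuous φ :=
      χ.continuous.mul (hg.div (hg.abs.add continuous_const) fun x ↦ (hpos x).ne')
    have hq : ∀ x, |g x / (|g x| + ε)| ≤ 1 := fun x ↦ by
      rw [abs_div, abs_of_pos (hpos x)]
      exact div_le_one_of_le₀ (by linarith) (hpos x).le
    have hφ1 : ∀ x, |φ x| ≤ 1 := fun x ↦ by
      rw [abs_mul, abs_of_nonneg (hχ01 x).1]
      exact mul_le_one₀ (hχ01 x).2 (abs_nonneg _) (hq x)
    have hle := integral_mul_le_of_forall_contDiff hw h hφ hχc.mul_right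
      ((closure_mono fun x hx ↦ left_ne_zero_of_mul hx).trans hχA) hφ1
    have hwφ : Integrable fun x ↦ w x * φ x :=
      hw.mul_bdd hφ.aestronglyMeasurable (.of_forall hφ1)
    have hi1 := hχi.const_mul ε
    have hi2 := (hw.sub hgi).norm.const_mul 2
    have h3 : ∫ x, χ x * |w x| ≤ ∫ x, (w x * φ x + ε * χ x + 2 * ‖(w - g) x‖) := by
      refine integral_mono hχw ((hwφ.add hi1).add hi2) fun x ↦ ?_
      have h4 : |w x| ≤ |g x| + |w x - g x| := by
        have := abs_sub_abs_le_abs_sub (w x) (g x)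
        linarith
      have h5 : |g x| - ε ≤ g x * (g x / (|g x| + ε)) := by
        rw [← mul_div_assoc, le_div_iff₀ (hpos x), ← abs_mul_abs_self (g x)]
        nlinarith
      have h6 : (g x - w x) * (g x / (|g x| + ε)) ≤ |w x - g x| := by
        refine (le_abs_self _).trans ?_
        rw [abs_mul, abs_sub_comm]
        exact mul_le_of_le_one_right (abs_nonneg _) (hq x)
      have h7 : |w x| ≤ w x * (g x / (|g x| + ε)) + ε + 2 * |w x - g x| := by linarith
      have h8 := mul_le_mul_of_nonneg_left h7 (hχ01 x).1
      have h9 : χ x * |w x - g x| ≤ |w x - g x| :=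
        mul_le_of_le_one_left (abs_nonneg _) (hχ01 x).2
      simp only [φ, Pi.sub_apply, Real.norm_eq_abs]
      linarith
    have h4 : ∫ x, (w x * φ x + ε * χ x + 2 * ‖(w - g) x‖)
        = (∫ x, w x * φ x) + ε * (∫ x, χ x) + 2 * ∫ x, ‖(w - g) x‖ := by
      rw [← integral_const_mul, ← integral_const_mul, ← integral_add hwφ hi1]
      exact integral_add (hwφ.add hi1) hi2
    rw [h4] at h3
    have h5 : ∫ x, ‖(w - g) x‖ ≤ ε := hgw
    linarith
  have hlim : Tendsto (fun ε : ℝ ↦ C + ε * (∫ x, χ x) + 2 * ε) (𝓝[>] 0)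
      (𝓝 (C + 0 * (∫ x, χ x) + 2 * 0)) :=
    (Continuous.tendsto (by fun_prop) 0).mono_left nhdsWithin_le_nhds
  have hC : ∫ x, χ x * |w x| ≤ C := by
    simpa using ge_of_tendsto hlim (eventually_mem_nhdsWithin.mono key)
  rw [withDensity_apply _ hK.measurableSet]
  calc ∫⁻ x in K, ‖w x‖ₑ ≤ ∫⁻ x in K, ENNReal.ofReal (χ x * |w x|) := by
        refine setLIntegral_mono' hK.measurableSet fun x hx ↦ ?_
        rw [hχ1 hx, Pi.one_apply, one_mul, ← Real.norm_eq_abs, ofReal_norm]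
    _ ≤ ∫⁻ x, ENNReal.ofReal (χ x * |w x|) := setLIntegral_le_lintegral _ _
    _ = ENNReal.ofReal (∫ x, χ x * |w x|) :=
        (ofReal_integral_eq_lintegral_ofReal hχw
          (.of_forall fun x ↦ mul_nonneg (hχ01 x).1 (abs_nonneg _))).symm
    _ ≤ ENNReal.ofReal C := ENNReal.ofReal_le_ofReal hC

/-- The extension by zero of a function on `Ω` to the whole space. -/
def zeroExt (u : L1 Ω) : Space d → ℝ := Ω.indicator u

theorem integrable_zeroExt (hΩ : IsOpen Ω) (u : L1 Ω) : Integrable (zeroExt u) :=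
  (integrable_indicator_iff hΩ.measurableSet).2 (L1.integrable_coeFn u)

theorem integral_zeroExt_mul_inner_gradient (hΩ : IsOpen Ω) (u : L1 Ω) {φ : Space d → ℝ}
    (hφ : ContDiff ℝ (⊤ : ℕ∞) φ) (hc : HasCompactSupport φ) (h : Space d) :
    ∫ x, zeroExt u x * ⟪h, gradient φ x⟫_ℝ = ⟪h, ∫ x in Ω, u x • gradient φ x⟫_ℝ := by
  obtain ⟨C, hC⟩ := exists_norm_gradient_le hφ hc
  have hint : Integrable (fun x ↦ u x • gradient φ x) (volume.restrict Ω) :=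
    (L1.integrable_coeFn u).smul_bdd C (continuous_gradient hφ).aestronglyMeasurable
      (.of_forall hC)
  rw [← integral_inner hint, ← integral_indicator hΩ.measurableSet]
  refine integral_congr_ae (.of_forall fun x ↦ ?_)
  by_cases hx : x ∈ Ω <;> simp [zeroExt, hx, inner_smul_right]

theorem gradient_comp_sub_const (φ : Space d → ℝ) (a x : Space d) :
    gradient (fun y ↦ φ (y - a)) x = gradient φ (x - a) := by
  rw [gradient, gradient, fderiv_comp_sub]

/-- The translation estimate `∫_A |u(x + h) - u(x)| dx ≤ |h| |Du|(Ω)`, for an open set `A` such that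
all segments `[x, x + h]` with `x ∈ A` are contained in `Ω`. Tested with `φ`, the left-hand side is
the increment over `[0, 1]` of `t ↦ ∫ u(x) φ(x - t h) dx`, whose derivative is
`∫ ⟪h, φ(x - t h)⟫ dDu(x)`. -/
theorem lintegral_enorm_translate_sub_le (hΩ : IsOpen Ω) {u : L1 Ω}
    {m : VectorMeasure Ω (Space d)} (hm : IsDeriv Ω u m) {A : Set (Space d)} (hA : IsOpen A)
    {h : Space d} (hseg : ∀ x ∈ A, ∀ t ∈ Icc (0 : ℝ) 1, x + t • h ∈ Ω) :
    ∫⁻ x in A, ‖zeroExt u (x + h) - zeroExt u x‖ₑ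
      ≤ ENNReal.ofReal (‖h‖ * m.variation.real univ) := by
  have hfin := hm.1
  have hU := integrable_zeroExt hΩ u
  refine lintegral_enorm_le_of_forall_contDiff hA ((hU.comp_add_right h).sub hU)
    fun φ hφ hφc hφA hφ1 ↦ ?_
  obtain ⟨C, hC⟩ := exists_norm_gradient_le hφ hφc
  have hφb : ∀ x, ‖φ x‖ ≤ 1 := hφ1
  let F : ℝ → ℝ := fun t ↦ ∫ x, zeroExt u x * φ (x - t • h)
  let F' : ℝ → ℝ := fun t ↦ ∫ x, zeroExt u x * (-⟪h, gradient φ (x - t • h)⟫_ℝ)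
  have hFint : ∀ a : Space d, Integrable fun x ↦ zeroExt u x * φ (x - a) := fun a ↦
    hU.mul_bdd (hφ.continuous.comp (continuous_id.sub continuous_const)).aestronglyMeasurable
      (.of_forall fun x ↦ hφb _)
  have hderiv : ∀ t, HasDerivAt F (F' t) t := fun t ↦ by
    refine (hasDerivAt_integral_of_dominated_loc_of_deriv_le (s := univ) (x₀ := t)
      (F := fun s x ↦ zeroExt u x * φ (x - s • h))
      (F' := fun s x ↦ zeroExt u x * (-⟪h, gradient φ (x - s • h)⟫_ℝ)) univ_mem
      (bound := fun x ↦ |zeroExt u x| * (‖h‖ * C)) (.of_forall fun s ↦ (hFint _).1) (hFint _)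
      ?_ (.of_forall fun x s _ ↦ ?_) (hU.abs.mul_const _) (.of_forall fun x s _ ↦ ?_)).2
    · refine hU.1.mul (Continuous.aestronglyMeasurable ?_)
      have := continuous_gradient hφ
      fun_prop
    · rw [norm_mul, norm_neg, Real.norm_eq_abs]
      gcongr
      refine (norm_inner_le_norm _ _).trans ?_
      gcongr
      exact hC _
    · refine HasDerivAt.const_mul _ ?_
      have h1 : HasFDerivAt φ (fderiv ℝ φ (x - s • h)) (x - s • h) :=
        (hφ.differentiable (by simp) _).hasFDerivAt
      have h2 : HasDerivAt (fun s : ℝ ↦ x - s • h) (-h) s := by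
        simpa using ((hasDerivAt_id s).smul_const h).const_sub x
      have h3 := h1.comp_hasDerivAt s h2
      have h4 : -⟪h, gradient φ (x - s • h)⟫_ℝ = fderiv ℝ φ (x - s • h) (-h) := by
        rw [map_neg, gradient, real_inner_comm, InnerProductSpace.toDual_symm_apply]
      rw [h4]
      exact h3
  have hbound : ∀ t ∈ Icc (0 : ℝ) 1, ‖F' t‖ ≤ ‖h‖ * m.variation.real univ := fun t ht ↦ by
    let φt : Space d → ℝ := fun y ↦ φ (y - t • h)
    have hφt : ContDiff ℝ (⊤ : ℕ∞) φt := hφ.comp (contDiff_id.sub contDiff_const)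
    have hφtc : HasCompactSupport φt := hφc.comp_homeomorph (Homeomorph.subRight (t • h))
    have hφts : tsupport φt ⊆ Ω := fun y hy ↦ by
      have : y - t • h ∈ tsupport φ :=
        tsupport_comp_subset_preimage φ (continuous_id.sub continuous_const) hy
      simpa using hseg _ (hφA this) t ht
    have h1 : F' t = ⟪h, m.integral (fun x : Ω ↦ φt x) (ContinuousLinearMap.lsmul ℝ ℝ)⟫_ℝ := by
      have h2 := integral_zeroExt_mul_inner_gradient hΩ u hφt hφtc h
      rw [hm.2 φt hφt hφtc hφts, inner_neg_right] at h2
      rw [← neg_eq_iff_eq_neg.2 h2, ← integral_neg]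
      refine integral_congr_ae (.of_forall fun x ↦ ?_)
      simp only [φt, gradient_comp_sub_const, mul_neg]
    rw [h1]
    refine (norm_inner_le_norm _ _).trans ?_
    gcongr
    simpa using norm_integral_le_mul_variation (m := m) zero_le_one fun x : Ω ↦ hφ1 (x - t • h)
  have hMV := norm_image_sub_le_of_norm_deriv_le_segment_01'
    (fun t _ ↦ (hderiv t).hasDerivWithinAt) fun t ht ↦ hbound t (Ico_subset_Icc_self ht)
  have hF : ∫ x, (zeroExt u (x + h) - zeroExt u x) * φ x = F 1 - F 0 := by
    have h1 : F 1 = ∫ x, zeroExt u (x + h) * φ x := by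
      simp only [F, one_smul]
      rw [← integral_add_right_eq_self _ h]
      simp
    have h2 : Integrable fun x ↦ zeroExt u (x + h) * φ x :=
      (hU.comp_add_right h).mul_bdd hφ.continuous.aestronglyMeasurable (.of_forall hφb)
    have h3 : Integrable fun x ↦ zeroExt u x * φ x := by simpa using hFint 0
    simp only [sub_mul]
    rw [integral_sub h2 h3, h1]
    simp [F]
  exact hF.trans_le ((le_abs_self _).trans hMV)

/-! ### Compactness of bounded sets of `BV` up to a Lipschitz boundary -/

/-- Near each point of `closure Ω` there is a ball of arbitrarily short displacements `h` such that
the segments `[y, y + h]` starting in `Ω` stay in `Ω`. At a boundary point these displacements point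
into the cone `K |h'| < ⟪ν, h⟫` above the Lipschitz graph. -/
theorem exists_ball_forall_add_smul_mem (hΩ : IsOpen Ω) (hL : HasLipschitzBoundary Ω) {x : Space d}
    (hx : x ∈ closure Ω) : ∃ ρ > 0, ∀ s > 0, ∃ (c : Space d) (κ : ℝ), 0 < κ ∧ ‖c‖ + κ ≤ s ∧
      ∀ y ∈ Ω ∩ Metric.ball x ρ, ∀ h ∈ Metric.ball c κ, ∀ t ∈ Icc (0 : ℝ) 1, y + t • h ∈ Ω := by
  by_cases hxΩ : x ∈ Ω
  · obtain ⟨r, hr, hball⟩ := Metric.isOpen_iff.1 hΩ x hxΩ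
    refine ⟨r / 2, by positivity, fun s hs ↦ ⟨0, min s (r / 2), by positivity, by simp,
      fun y hy h hh t ht ↦ hball ?_⟩⟩
    have h1 : ‖y - x‖ < r / 2 := by simpa [dist_eq_norm] using hy.2
    have h2 : ‖h‖ < r / 2 := (lt_min_iff.1 (by simpa using hh)).2
    have h3 : ‖t • h‖ ≤ ‖h‖ := by
      rw [norm_smul, Real.norm_of_nonneg ht.1]
      exact mul_le_of_le_one_left (norm_nonneg _) ht.2
    rw [Metric.mem_ball, dist_eq_norm, add_sub_right_comm]
    linarith [norm_add_le (y - x) (t • h)]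
  · obtain ⟨r, ν, K, g, hr, hν, hg, hgraph⟩ := hL x (by rw [hΩ.frontier_eq]; exact ⟨hx, hxΩ⟩)
    refine ⟨r / 2, by positivity, fun s hs ↦ ?_⟩
    obtain ⟨σ, hσ, hσs, hσr⟩ : ∃ σ > 0, 2 * σ ≤ s ∧ 2 * σ ≤ r / 2 :=
      ⟨min s (r / 2) / 2, by positivity, by linarith [min_le_left s (r / 2)],
        by linarith [min_le_right s (r / 2)]⟩
    have hK : (0 : ℝ) ≤ K := K.2
    -- this `κ` satisfies `K * (2 * κ) = σ - κ`
    obtain ⟨κ, hκ, hκσ⟩ : ∃ κ > 0, (2 * K + 1) * κ = σ :=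
      ⟨σ / (2 * K + 1), by positivity, by field_simp⟩
    have hκle : κ ≤ σ := by nlinarith
    have hc : ‖σ • ν‖ = σ := by rw [norm_smul, hν, mul_one, Real.norm_of_nonneg hσ.le]
    refine ⟨σ • ν, κ, hκ, by rw [hc]; linarith, fun y hy h hh t ht ↦ ?_⟩
    obtain ⟨e, he, rfl⟩ : ∃ e : Space d, ‖e‖ < κ ∧ σ • ν + e = h :=
      ⟨h - σ • ν, by simpa [dist_eq_norm] using hh, by abel⟩
    have hyx : ‖y - x‖ < r / 2 := by simpa [dist_eq_norm] using hy.2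
    have hth : ‖t • (σ • ν + e)‖ < r / 2 := by
      rw [norm_smul, Real.norm_of_nonneg ht.1]
      have h1 := norm_add_le (σ • ν) e
      have h2 : t * ‖σ • ν + e‖ ≤ ‖σ • ν + e‖ := mul_le_of_le_one_left (norm_nonneg _) ht.2
      linarith
    have hmem : y + t • (σ • ν + e) ∈ Metric.ball x r := by
      rw [Metric.mem_ball, dist_eq_norm, add_sub_right_comm]
      linarith [norm_add_le (y - x) (t • (σ • ν + e))]
    have hyr : y ∈ Metric.ball x r := Metric.ball_subset_ball (by linarith) hy.2
    have hgy := (hgraph y hyr).1 hy.1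
    refine (hgraph _ hmem).2 ?_
    have hνν : ⟪ν, ν⟫_ℝ = 1 := by rw [real_inner_self_eq_norm_sq, hν, one_pow]
    have hνe : |⟪ν, e⟫_ℝ| ≤ ‖e‖ := by simpa [hν] using abs_real_inner_le_norm ν e
    have hinner : ⟪ν, y + t • (σ • ν + e)⟫_ℝ = ⟪ν, y⟫_ℝ + t * (σ + ⟪ν, e⟫_ℝ) := by
      simp only [inner_add_right, inner_smul_right, hνν, mul_one]
    have hproj : y + t • (σ • ν + e) - ⟪ν, y + t • (σ • ν + e)⟫_ℝ • ν - (y - ⟪ν, y⟫_ℝ • ν)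
        = t • (e - ⟪ν, e⟫_ℝ • ν) := by
      rw [hinner]
      module
    have hlip := hg.dist_le_mul (y + t • (σ • ν + e) - ⟪ν, y + t • (σ • ν + e)⟫_ℝ • ν)
      (y - ⟪ν, y⟫_ℝ • ν)
    rw [dist_eq_norm, dist_eq_norm, hproj, norm_smul, Real.norm_of_nonneg ht.1] at hlip
    have hPe : ‖e - ⟪ν, e⟫_ℝ • ν‖ ≤ 2 * κ := by
      refine (norm_sub_le _ _).trans ?_
      rw [norm_smul, hν, mul_one, Real.norm_eq_abs]
      linarith
    have h1 := (le_abs_self _).trans hlip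
    have h2 : K * (t * ‖e - ⟪ν, e⟫_ℝ • ν‖) ≤ t * (K * (2 * κ)) := by
      rw [mul_left_comm]
      exact mul_le_mul_of_nonneg_left (mul_le_mul_of_nonneg_left hPe hK) ht.1
    have h3 : t * (K * (2 * κ)) ≤ t * (σ + ⟪ν, e⟫_ℝ) := by
      refine mul_le_mul_of_nonneg_left ?_ ht.1
      linarith [(abs_le.1 hνe).1]
    linarith

/-- Averaging the translates of `U` with a probability density `η` moves `U` in `L¹(A)` by no more
than the translations themselves do. -/
theorem lintegral_enorm_average_sub_le {U η : Space d → ℝ} (hUm : Measurable U)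
    (hU : Integrable U) (hη : Continuous η) (hηc : HasCompactSupport η) (hη0 : ∀ h, 0 ≤ η h)
    (hη1 : ∫ h, η h = 1) {A : Set (Space d)} {C : ℝ≥0∞}
    (hC : ∀ h, η h ≠ 0 → ∫⁻ x in A, ‖U (x + h) - U x‖ₑ ≤ C) :
    ∫⁻ x in A, ‖(∫ h, U (x + h) * η h) - U x‖ₑ ≤ C := by
  obtain ⟨B, hB⟩ := hη.bounded_above_of_compact_support hηc
  have hηi := hη.integrable_of_hasCompactSupport (μ := volume) hηc
  have h1 : ∀ x, (∫ h, U (x + h) * η h) - U x = ∫ h, (U (x + h) - U x) * η h := fun x ↦ by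
    simp only [sub_mul]
    rw [integral_sub ((hU.comp_add_left x).mul_bdd hη.aestronglyMeasurable (.of_forall hB))
      (hηi.const_mul _), integral_const_mul, hη1, mul_one]
  calc ∫⁻ x in A, ‖(∫ h, U (x + h) * η h) - U x‖ₑ
      ≤ ∫⁻ x in A, ∫⁻ h, ‖U (x + h) - U x‖ₑ * ‖η h‖ₑ := by
        refine lintegral_mono fun x ↦ ?_
        rw [h1]
        refine (enorm_integral_le_lintegral_enorm _).trans_eq ?_
        simp only [enorm_mul]
    _ = ∫⁻ h, ∫⁻ x in A, ‖U (x + h) - U x‖ₑ * ‖η h‖ₑ := by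
        refine lintegral_lintegral_swap (Measurable.aemeasurable ?_)
        have := hη.measurable
        simp only [Function.uncurry_def]
        fun_prop
    _ = ∫⁻ h, (∫⁻ x in A, ‖U (x + h) - U x‖ₑ) * ‖η h‖ₑ := by
        refine lintegral_congr fun h ↦ ?_
        exact lintegral_mul_const _ (by fun_prop)
    _ ≤ ∫⁻ h, C * ‖η h‖ₑ := by
        refine lintegral_mono fun h ↦ ?_
        by_cases hh : η h = 0
        · simp [hh]
        · exact mul_le_mul_left (hC h hh) _
    _ = C := by
        rw [lintegral_const_mul _ hη.measurable.enorm,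
          ← ofReal_integral_norm_eq_lintegral_enorm hηi]
        simp only [Real.norm_of_nonneg (hη0 _), hη1, ENNReal.ofReal_one, mul_one]

theorem measurable_zeroExt (hΩ : IsOpen Ω) (u : L1 Ω) : Measurable (zeroExt u) :=
  (Lp.stronglyMeasurable u).measurable.indicator hΩ.measurableSet

theorem integral_abs_zeroExt (hΩ : IsOpen Ω) (u : L1 Ω) : ∫ x, |zeroExt u x| = ‖u‖ := by
  rw [L1.norm_eq_integral_norm, ← integral_indicator hΩ.measurableSet]
  refine integral_congr_ae (.of_forall fun x ↦ ?_)
  by_cases hx : x ∈ Ω <;> simp [zeroExt, hx]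

theorem integral_zeroExt_add_mul (u : L1 Ω) (η : Space d → ℝ) (x : Space d) :
    ∫ h, zeroExt u (x + h) * η h = ∫ z, zeroExt u z * η (z - x) := by
  rw [← integral_sub_right_eq_self (fun h ↦ zeroExt u (x + h) * η h) x]
  simp

theorem abs_integral_zeroExt_mul_le (hΩ : IsOpen Ω) (u : L1 Ω) {f : Space d → ℝ} {B : ℝ}
    (hB : ∀ x, |f x| ≤ B) : |∫ z, zeroExt u z * f z| ≤ ‖u‖ * B := by
  rw [← integral_abs_zeroExt hΩ u, ← integral_mul_const]
  refine norm_integral_le_of_norm_le (f := fun z ↦ zeroExt u z * f z)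
    ((integrable_zeroExt hΩ u).abs.mul_const B)
    (.of_forall fun x ↦ ?_)
  rw [Real.norm_eq_abs, abs_mul]
  exact mul_le_mul_of_nonneg_left (hB x) (abs_nonneg _)

/-- The functions of `L¹` norm and total variation at most `M`. -/
def boundedBV (Ω : Set (Space d)) (M : ℝ) : Set (L1 Ω) :=
  {u | ‖u‖ ≤ M ∧ ∃ m, IsDeriv Ω u m ∧ m.variation.real univ ≤ M}

/-- Local compactness up to the boundary: along an ultrafilter, a bounded set of `BV(Ω)` is Cauchy
in `L¹` near each point of `closure Ω`. The averages over short displacements into `Ω` are uniformly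
close to the functions in `L¹`, and they are equicontinuous, hence determined up to a small error by
their values on a finite set. -/
theorem exists_ball_forall_ultrafilter (hΩ : IsBoundedLipschitzDomain Ω) {M : ℝ} (hM : 0 ≤ M)
    {x₀ : Space d} (hx₀ : x₀ ∈ closure Ω) :
    ∃ ρ > 0, ∀ U : Ultrafilter (L1 Ω), boundedBV Ω M ∈ U → ∀ ε > 0, ∃ t ∈ U, ∀ u ∈ t, ∀ w ∈ t,
      ∫⁻ x in Ω ∩ Metric.ball x₀ ρ, ‖zeroExt u x - zeroExt w x‖ₑ ≤ ENNReal.ofReal ε := by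
  have hΩo := hΩ.isOpen
  obtain ⟨ρ, hρ, hball⟩ := exists_ball_forall_add_smul_mem hΩo hΩ.lipschitz hx₀
  refine ⟨ρ, hρ, fun U hU ε hε ↦ ?_⟩
  set A := Ω ∩ Metric.ball x₀ ρ with hAdef
  have hAo : IsOpen A := hΩo.inter Metric.isOpen_ball
  have hAb : Bornology.IsBounded A := hΩ.isBounded.subset inter_subset_left
  have hAtop : volume A ≠ ∞ := hAb.measure_lt_top.ne
  set V := volume.real A with hV
  have hV0 : 0 ≤ V := measureReal_nonneg
  obtain ⟨s, hs, hsM⟩ : ∃ s > 0, s * M ≤ ε / 4 := by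
    refine ⟨ε / (4 * (M + 1)), by positivity, ?_⟩
    rw [div_mul_eq_mul_div, div_le_div_iff₀ (by positivity) (by positivity)]
    nlinarith
  obtain ⟨δ, hδ, hδV⟩ : ∃ δ > 0, (2 * M + 2) * δ * V ≤ ε / 2 := by
    refine ⟨ε / (4 * (M + 1) * (V + 1)), by positivity, ?_⟩
    have : (2 * M + 2) * (ε / (4 * (M + 1) * (V + 1))) * V = ε / 2 * (V / (V + 1)) := by
      field_simp
      ring
    rw [this]
    exact mul_le_of_le_one_right (by positivity) (div_le_one_of_le₀ (by linarith) (by positivity))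
  obtain ⟨c, κ, hκ, hcκ, hseg⟩ := hball s hs
  let b : ContDiffBump c := ⟨κ / 2, κ, by positivity, by linarith⟩
  let η : Space d → ℝ := b.normed volume
  have hηcont : Continuous η := b.continuous_normed
  have hηc : HasCompactSupport η := b.hasCompactSupport_normed
  have hηball : ∀ h, η h ≠ 0 → h ∈ Metric.ball c κ := fun h hh ↦ by
    have : h ∈ Function.support (b.normed volume) := hh
    rwa [b.support_normed_eq] at this
  obtain ⟨B, hB⟩ := hηcont.bounded_above_of_compact_support hηc
  let T : L1 Ω → Space d → ℝ := fun u x ↦ ∫ z, zeroExt u z * η (z - x)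
  have hTU : ∀ u ∈ boundedBV Ω M,
      ∫⁻ x in A, ‖T u x - zeroExt u x‖ₑ ≤ ENNReal.ofReal (s * M) := by
    rintro u ⟨-, m, hm, hmM⟩
    have := lintegral_enorm_average_sub_le (measurable_zeroExt hΩo u) (integrable_zeroExt hΩo u)
      hηcont hηc b.nonneg_normed b.integral_normed (A := A) (C := ENNReal.ofReal (s * M))
      fun h hh ↦ by
        have hhb := hηball h hh
        refine (lintegral_enorm_translate_sub_le hΩo hm hAo
          fun y hy t ht ↦ hseg y hy h hhb t ht).trans (ENNReal.ofReal_le_ofReal ?_)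
        have h1 : ‖h‖ ≤ s := by
          have h2 : ‖h - c‖ < κ := by simpa [dist_eq_norm] using hhb
          have h3 := norm_le_norm_add_norm_sub' h c
          linarith
        exact mul_le_mul h1 hmM measureReal_nonneg hs.le
    simpa only [T, integral_zeroExt_add_mul] using this
  have huc : UniformContinuous η := hηc.uniformContinuous_of_continuous hηcont
  obtain ⟨δ', hδ', hηδ⟩ := Metric.uniformContinuous_iff.1 huc δ hδ
  have hTint : ∀ (u : L1 Ω) x, Integrable fun z ↦ zeroExt u z * η (z - x) := fun u x ↦
    (integrable_zeroExt hΩo u).mul_bdd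
      (hηcont.comp (continuous_id.sub continuous_const)).aestronglyMeasurable
      (.of_forall fun z ↦ hB _)
  have hTcont : ∀ u ∈ boundedBV Ω M, ∀ x y, dist x y < δ' → |T u x - T u y| ≤ M * δ := by
    rintro u ⟨huM, -⟩ x y hxy
    have h1 : T u x - T u y = ∫ z, zeroExt u z * (η (z - x) - η (z - y)) := by
      simp only [mul_sub]
      exact (integral_sub (hTint u x) (hTint u y)).symm
    rw [h1]
    refine (abs_integral_zeroExt_mul_le hΩo u (B := δ) fun z ↦ ?_).trans (by gcongr)
    exact (hηδ (by rwa [dist_sub_left])).le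
  have hTbd : ∀ u ∈ boundedBV Ω M, ∀ x, |T u x| ≤ M * |B| := by
    rintro u ⟨huM, -⟩ x
    refine (abs_integral_zeroExt_mul_le hΩo u (B := |B|) fun z ↦ ?_).trans (by gcongr)
    exact (hB _).trans (le_abs_self B)
  have hlim : ∀ x, ∃ a, Tendsto (fun u ↦ T u x) U (𝓝 a) := fun x ↦ by
    obtain ⟨a, -, ha⟩ := (isCompact_Icc (a := -(M * |B|)) (b := M * |B|)).ultrafilter_le_nhds
      (U.map fun u ↦ T u x) (by
        simp only [le_principal_iff, Ultrafilter.mem_coe, Ultrafilter.mem_map]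
        exact mem_of_superset hU fun u hu ↦ abs_le.1 (hTbd u hu x))
    exact ⟨a, ha⟩
  choose a ha using hlim
  have hAtb : TotallyBounded A := hAb.isCompact_closure.totallyBounded.subset subset_closure
  obtain ⟨N, hNfin, hN⟩ := Metric.totallyBounded_iff.1 hAtb δ' hδ'
  have hsmall : ∀ᶠ u in (U : Filter (L1 Ω)), ∀ p ∈ N, |T u p - a p| < δ :=
    hNfin.eventually_all.2 fun p _ ↦ (ha p).eventually (Metric.ball_mem_nhds (a p) hδ)
  refine ⟨_, inter_mem hU hsmall, fun u hu w hw ↦ ?_⟩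
  have hTT : ∀ x ∈ A, |T u x - T w x| ≤ (2 * M + 2) * δ := fun x hx ↦ by
    obtain ⟨p, hp, hxp⟩ := mem_iUnion₂.1 (hN hx)
    have h1 := abs_le.1 (hTcont u hu.1 x p hxp)
    have h2 := abs_le.1 (hTcont w hw.1 x p hxp)
    have h3 := abs_lt.1 (hu.2 p hp)
    have h4 := abs_lt.1 (hw.2 p hp)
    rw [abs_le]
    constructor <;> linarith
  have hTm : ∀ u, Measurable (T u) := fun u ↦ by
    refine (StronglyMeasurable.integral_prod_left (μ := volume)
      (f := fun z x ↦ zeroExt u z * η (z - x)) (Measurable.stronglyMeasurable ?_)).measurable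
    have h1 := measurable_zeroExt hΩo u
    have h2 := hηcont.measurable
    simp only [Function.uncurry_def]
    fun_prop
  have hu' := measurable_zeroExt hΩo u
  have hw' := measurable_zeroExt hΩo w
  calc ∫⁻ x in A, ‖zeroExt u x - zeroExt w x‖ₑ
      ≤ ∫⁻ x in A, (‖T u x - zeroExt u x‖ₑ + ‖T w x - zeroExt w x‖ₑ
          + ENNReal.ofReal ((2 * M + 2) * δ)) := by
        refine setLIntegral_mono' hAo.measurableSet fun x hx ↦ ?_
        have h1 : zeroExt u x - zeroExt w x
            = -(T u x - zeroExt u x) + (T w x - zeroExt w x) + (T u x - T w x) := by ring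
        rw [h1]
        refine (enorm_add_le _ _).trans
          (add_le_add ((enorm_add_le _ _).trans_eq (by rw [enorm_neg])) ?_)
        rw [← ofReal_norm]
        exact ENNReal.ofReal_le_ofReal (hTT x hx)
    _ = (∫⁻ x in A, ‖T u x - zeroExt u x‖ₑ) + (∫⁻ x in A, ‖T w x - zeroExt w x‖ₑ)
          + ENNReal.ofReal ((2 * M + 2) * δ) * volume A := by
        rw [lintegral_add_right _ measurable_const, setLIntegral_const,
          lintegral_add_left (f := fun x ↦ ‖T u x - zeroExt u x‖ₑ) ((hTm u).sub hu').enorm]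
    _ ≤ ENNReal.ofReal (s * M) + ENNReal.ofReal (s * M)
          + ENNReal.ofReal ((2 * M + 2) * δ * V) := by
        refine add_le_add (add_le_add (hTU u hu.1) (hTU w hw.1)) (le_of_eq ?_)
        rw [ENNReal.ofReal_mul (p := (2 * M + 2) * δ) (by positivity), hV, ofReal_measureReal hAtop]
    _ ≤ ENNReal.ofReal ε := by
        rw [← ENNReal.ofReal_add (by positivity) (by positivity),
          ← ENNReal.ofReal_add (by positivity) (by positivity)]
        exact ENNReal.ofReal_le_ofReal (by linarith)

/-- Bounded subsets of `BV(Ω)` are totally bounded in `L¹(Ω)`. -/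
theorem totallyBounded_boundedBV (hΩ : IsBoundedLipschitzDomain Ω) {M : ℝ} (hM : 0 ≤ M) :
    TotallyBounded (boundedBV Ω M) := by
  have hΩo := hΩ.isOpen
  rw [totallyBounded_iff_ultrafilter]
  intro U hU
  replace hU : boundedBV Ω M ∈ U := le_principal_iff.1 hU
  rw [Metric.cauchy_iff]
  refine ⟨U.neBot, fun ε hε ↦ ?_⟩
  choose! ρ hρ hloc using fun x (hx : x ∈ closure Ω) ↦ exists_ball_forall_ultrafilter hΩ hM hx
  obtain ⟨N, hN, hcov⟩ := hΩ.isBounded.isCompact_closure.elim_nhds_subcover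
    (fun x ↦ Metric.ball x (ρ x)) fun x hx ↦ Metric.ball_mem_nhds x (hρ x hx)
  set ε' := ε / (N.card + 1) with hε'
  have hε'0 : 0 < ε' := by positivity
  choose! t ht htd using fun x hx ↦ hloc x hx U hU ε' hε'0
  refine ⟨⋂ x ∈ N, t x, (biInter_finset_mem N).2 fun x hx ↦ ht x (hN x hx), fun u hu w hw ↦ ?_⟩
  have h1 : edist u w ≤ ENNReal.ofReal (N.card * ε') := by
    calc edist u w = ∫⁻ x in Ω, ‖zeroExt u x - zeroExt w x‖ₑ := by
          rw [L1.edist_def]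
          refine setLIntegral_congr_fun hΩo.measurableSet fun x hx ↦ ?_
          simp [zeroExt, hx, edist_eq_enorm_sub]
      _ ≤ ∫⁻ x in ⋃ p : N, Ω ∩ Metric.ball p (ρ p), ‖zeroExt u x - zeroExt w x‖ₑ := by
          refine lintegral_mono_set fun x hx ↦ ?_
          obtain ⟨p, hp, hxp⟩ := mem_iUnion₂.1 (hcov (subset_closure hx))
          exact mem_iUnion.2 ⟨⟨p, hp⟩, hx, hxp⟩
      _ ≤ ∑ p : N, ENNReal.ofReal ε' := by
          refine (lintegral_iUnion_le _ _).trans ?_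
          rw [tsum_fintype]
          refine Finset.sum_le_sum fun p _ ↦ htd p (hN p p.2) u ?_ w ?_
          · exact mem_iInter₂.1 hu p p.2
          · exact mem_iInter₂.1 hw p p.2
      _ = ENNReal.ofReal (N.card * ε') := by
          rw [Finset.sum_const, nsmul_eq_mul, ENNReal.ofReal_mul (by positivity)]
          simp
  rw [edist_dist, ENNReal.ofReal_le_ofReal_iff (by positivity)] at h1
  refine h1.trans_lt ?_
  rw [hε', mul_div_assoc', div_lt_iff₀ (by positivity)]
  nlinarith

/-- Rellich's theorem for `BV` on a bounded Lipschitz domain. -/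
theorem exists_subseq_tendsto_of_bounded (hΩ : IsBoundedLipschitzDomain Ω) {u : ℕ → L1 Ω}
    {m : ℕ → VectorMeasure Ω (Space d)} {M : ℝ} (hm : ∀ n, IsDeriv Ω (u n) (m n))
    (hmM : ∀ n, (m n).variation.real univ ≤ M) (hu : ∀ n, ‖u n‖ ≤ M) :
    ∃ (u' : L1 Ω) (b : ℕ → ℕ), StrictMono b ∧ Tendsto (u ∘ b) atTop (𝓝 u') := by
  have hM : 0 ≤ M := (norm_nonneg _).trans (hu 0)
  have hK : IsCompact (closure (boundedBV Ω M)) :=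
    (totallyBounded_boundedBV hΩ hM).closure.isCompact_of_isClosed isClosed_closure
  obtain ⟨u', -, b, hb, hlim⟩ := hK.tendsto_subseq
    fun n ↦ subset_closure (⟨hu n, m n, hm n, hmM n⟩ : u n ∈ boundedBV Ω M)
  exact ⟨u', b, hb, hlim⟩

/-! ### Energies and approximating problems -/

variable {J : L1 Ω → ℝ≥0∞}

theorem isDeriv_zero : IsDeriv Ω 0 0 := by
  refine ⟨by rw [VectorMeasure.variation_zero]; infer_instance, fun φ _ _ _ ↦ ?_⟩
  rw [VectorMeasure.integral_zero_vectorMeasure, neg_zero]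
  refine integral_eq_zero_of_ae ?_
  filter_upwards [Lp.coeFn_zero ℝ 1 ((volume : Measure (Space d)).restrict Ω)] with x hx
  simp only [hx, Pi.zero_apply, zero_smul]

theorem IsDeriv.add {u w : L1 Ω} {m n : VectorMeasure Ω (Space d)} (hm : IsDeriv Ω u m)
    (hn : IsDeriv Ω w n) : IsDeriv Ω (u + w) (m + n) := by
  have := hm.1
  have := hn.1
  refine ⟨isFiniteMeasure_of_le _ VectorMeasure.variation_add_le, fun φ hφ hc hs ↦ ?_⟩
  have hφi : ∀ (μ : Measure Ω) [IsFiniteMeasure μ], Integrable (fun x : Ω ↦ φ x) μ := fun μ _ ↦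
    (hφ.continuous.comp continuous_subtype_val).integrable_of_hasCompactSupport
      (hasCompactSupport_restrict hc hs)
  rw [VectorMeasure.integral_add_vectorMeasure (hφi _) (hφi _), neg_add, ← hm.2 φ hφ hc hs,
    ← hn.2 φ hφ hc hs]
  obtain ⟨C, hC⟩ := exists_norm_gradient_le hφ hc
  have hint : ∀ u : L1 Ω, Integrable (fun x ↦ u x • gradient φ x) (volume.restrict Ω) := fun u ↦
    (L1.integrable_coeFn u).smul_bdd C (continuous_gradient hφ).aestronglyMeasurable
      (.of_forall hC)
  rw [← integral_add (hint u) (hint w)]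
  refine integral_congr_ae ?_
  filter_upwards [Lp.coeFn_add u w] with x hx
  simp only [hx, Pi.add_apply, add_smul]

theorem IsDeriv.smul {u : L1 Ω} {m : VectorMeasure Ω (Space d)} (hm : IsDeriv Ω u m) (c : ℝ) :
    IsDeriv Ω (c • u) (c • m) := by
  have := hm.1
  refine ⟨by rw [VectorMeasure.variation_smul]; infer_instance, fun φ hφ hc hs ↦ ?_⟩
  rw [VectorMeasure.integral_smul_vectorMeasure, ← smul_neg, ← hm.2 φ hφ hc hs, ← integral_smul]
  refine integral_congr_ae ?_
  filter_upwards [Lp.coeFn_smul c u] with x hx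
  simp only [hx, Pi.smul_apply, smul_smul, smul_eq_mul]

theorem zero_mem_BV : (0 : L1 Ω) ∈ BV Ω := ⟨0, isDeriv_zero⟩

theorem IsRegulariser.map_zero (hJ : IsRegulariser Ω J) : J 0 = 0 := by
  obtain ⟨C₁, C₂, -, -, h⟩ := hJ.comparable
  have h0 : totalVar Ω (0 : L1 Ω) = 0 :=
    le_antisymm ((iInf₂_le 0 isDeriv_zero).trans (by simp)) zero_le
  simpa [h0] using (h 0 zero_mem_BV).2

/-- A bound on the regulariser bounds the total mass of the derivative. -/
theorem IsRegulariser.exists_isDeriv_le (hJ : IsRegulariser Ω J) {B : ℝ≥0∞} (hB : B ≠ ∞) :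
    ∃ M : ℝ, ∀ u ∈ BV Ω, J u ≤ B → ∃ m, IsDeriv Ω u m ∧ m.variation.real univ ≤ M := by
  obtain ⟨C₁, C₂, hC₁, -, h⟩ := hJ.comparable
  refine ⟨(B / C₁ + 1).toReal, fun u hu hJu ↦ ?_⟩
  have hC₁' : (C₁ : ℝ≥0∞) ≠ 0 := by simpa using hC₁.ne'
  have hfin : B / C₁ ≠ ∞ := ENNReal.div_ne_top hB hC₁'
  have h1 : totalVar Ω u < B / C₁ + 1 := by
    refine lt_of_le_of_lt ?_ (ENNReal.lt_add_right hfin one_ne_zero)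
    rw [ENNReal.le_div_iff_mul_le (.inl hC₁') (.inl ENNReal.coe_ne_top), mul_comm]
    exact (h u hu).1.trans hJu
  obtain ⟨m, hm⟩ := iInf_lt_iff.1 h1
  obtain ⟨hmu, hm⟩ := iInf_lt_iff.1 hm
  exact ⟨m, hmu, ENNReal.toReal_mono (by finiteness) hm.le⟩

/-- The two parts of the theorem have a common scheme: the minimisers `u n` of the approximating
problems are bounded in `BV(Ω)`, their optimal values `opt n` stay below the limit energy `E`, and
`E` is a lower bound for the optimal values along each subsequence that converges in `L¹(Ω)`. -/
structure ApproximatesEnergy (Ω : Set (Space d)) (J E : L1 Ω → ℝ≥0∞) (u : ℕ → L1 Ω)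
    (opt : ℕ → ℝ≥0∞) : Prop where
  mem_BV : ∀ n, u n ∈ BV Ω
  le_opt : ∀ n, J (u n) ≤ opt n
  opt_le : ∀ n, ∀ w ∈ BV Ω, opt n ≤ E w
  zero_ne_top : E 0 ≠ ∞
  norm_le : ∃ R, ∀ n, ‖u n‖ ≤ R
  lt_opt : ∀ (σ : ℕ → ℕ) (u' : L1 Ω), Tendsto σ atTop atTop → Tendsto (u ∘ σ) atTop (𝓝 u') →
    ∀ c < E u', ∀ᶠ k in atTop, c < opt (σ k)

namespace ApproximatesEnergy

variable {E : L1 Ω → ℝ≥0∞} {u : ℕ → L1 Ω} {opt : ℕ → ℝ≥0∞}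

theorem exists_isDeriv (h : ApproximatesEnergy Ω J E u opt) (hJ : IsRegulariser Ω J) :
    ∃ M : ℝ, ∃ m : ℕ → VectorMeasure Ω (Space d), ∀ n, IsDeriv Ω (u n) (m n) ∧
      (m n).variation.real univ ≤ M := by
  obtain ⟨M, hM⟩ := hJ.exists_isDeriv_le h.zero_ne_top
  choose m hm using fun n ↦ hM (u n) (h.mem_BV n) ((h.le_opt n).trans (h.opt_le n 0 zero_mem_BV))
  exact ⟨M, m, hm⟩

theorem tendstoWeakStarBV (h : ApproximatesEnergy Ω J E u opt) (hJ : IsRegulariser Ω J)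
    (hΩ : IsOpen Ω) {σ : ℕ → ℕ} {u' : L1 Ω} (hu : Tendsto (fun k ↦ u (σ k)) atTop (𝓝 u')) :
    TendstoWeakStarBV Ω (fun k ↦ u (σ k)) u' := by
  obtain ⟨M, m, hm⟩ := h.exists_isDeriv hJ
  exact tendstoWeakStarBV_of_tendsto hΩ (fun k ↦ (hm (σ k)).1) (fun k ↦ (hm (σ k)).2) hu

theorem isMinimiserBV (h : ApproximatesEnergy Ω J E u opt) (hJ : IsRegulariser Ω J)
    (hΩ : IsOpen Ω) {σ : ℕ → ℕ} {u' : L1 Ω} (hσ : Tendsto σ atTop atTop)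
    (hu : Tendsto (fun k ↦ u (σ k)) atTop (𝓝 u')) : IsMinimiserBV Ω E u' := by
  obtain ⟨-, -, m', -, hm', -⟩ := h.tendstoWeakStarBV hJ hΩ hu
  refine ⟨⟨m', hm'⟩, fun w hw ↦ le_of_forall_lt fun c hc ↦ ?_⟩
  obtain ⟨k, hk⟩ := (h.lt_opt σ u' hσ hu c hc).exists
  exact hk.trans_le (h.opt_le _ w hw)

theorem exists_subseq (h : ApproximatesEnergy Ω J E u opt) (hJ : IsRegulariser Ω J)
    (hΩ : IsBoundedLipschitzDomain Ω) (σ : ℕ → ℕ) :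
    ∃ (b : ℕ → ℕ) (u' : L1 Ω), StrictMono b ∧ Tendsto (fun k ↦ u (σ (b k))) atTop (𝓝 u') := by
  obtain ⟨M, m, hm⟩ := h.exists_isDeriv hJ
  obtain ⟨R, hR⟩ := h.norm_le
  obtain ⟨u', b, hb, hlim⟩ := exists_subseq_tendsto_of_bounded hΩ (u := fun k ↦ u (σ k))
    (M := max M R) (fun k ↦ (hm (σ k)).1) (fun k ↦ (hm (σ k)).2.trans (le_max_left _ _))
    fun k ↦ (hR (σ k)).trans (le_max_right _ _)
  exact ⟨b, u', hb, hlim⟩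

theorem tendsto_of_unique (h : ApproximatesEnergy Ω J E u opt) (hJ : IsRegulariser Ω J)
    (hΩ : IsBoundedLipschitzDomain Ω) {u' : L1 Ω} (hu' : IsMinimiserBV Ω E u')
    (huniq : ∀ w, IsMinimiserBV Ω E w → w = u') :
    TendstoWeakStarBV Ω u u' ∧ Tendsto opt atTop (𝓝 (E u')) := by
  have hlim : Tendsto u atTop (𝓝 u') := tendsto_of_subseq_tendsto fun ns hns ↦ by
    obtain ⟨b, w, hb, hw⟩ := h.exists_subseq hJ hΩ ns
    refine ⟨b, ?_⟩
    rwa [← huniq w (h.isMinimiserBV hJ hΩ.isOpen (hns.comp hb.tendsto_atTop) hw)]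
  refine ⟨h.tendstoWeakStarBV hJ hΩ.isOpen (σ := id) hlim, tendsto_order.2
    ⟨fun c hc ↦ h.lt_opt id u' tendsto_id hlim c hc, fun c hc ↦
      .of_forall fun n ↦ (h.opt_le n u' hu'.1).trans_lt hc⟩⟩

end ApproximatesEnergy

theorem lowerSemicontinuous_eLpNorm_coeFn {X : Type*} [MeasurableSpace X] {μ : Measure X}
    (p : ℝ≥0∞) : LowerSemicontinuous fun g : Lp ℝ 1 μ ↦ eLpNorm g p μ := by
  rw [lowerSemicontinuous_iff_isClosed_preimage]
  intro c
  refine IsSeqClosed.isClosed fun g g' hg hlim ↦ ?_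
  obtain ⟨ns, -, hns⟩ := (tendstoInMeasure_of_tendsto_Lp hlim).exists_seq_tendsto_ae
  refine (Lp.eLpNorm_lim_le_liminf_eLpNorm (fun n ↦ Lp.aestronglyMeasurable _) _ hns).trans ?_
  refine (liminf_le_liminf (.of_forall fun n ↦ hg (ns n))).trans ?_
  simp

theorem enorm_eq_normOn_one (v : L1 Ω) : ‖v‖ₑ = normOn Ω 1 v := Lp.enorm_def v

/-- The optimal pair attains the infimum that defines the infimal convolution fidelity. -/
theorem IsOptimalPair.add_icFidelity {lam₁ lam₂ : ℝ≥0} {f : Space d → ℝ} {u v : L1 Ω}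
    (h : IsOptimalPair Ω J lam₁ lam₂ f u v) :
    J u + icFidelity Ω lam₁ lam₂ f u = J u + splitFidelity Ω lam₁ lam₂ f u v := by
  refine le_antisymm (add_le_add le_rfl (iInf_le _ v)) ?_
  rw [icFidelity, ENNReal.add_iInf]
  exact le_iInf fun z ↦ h.2 u h.1 z

theorem normOn_sub_eq_eLpNorm {f : Space d → ℝ} (hf : MemLp f 1 (volume.restrict Ω)) (p : ℝ≥0∞)
    (u : L1 Ω) : normOn Ω p (fun x ↦ f x - u x)
      = eLpNorm (hf.toLp f - u : L1 Ω) p (volume.restrict Ω) := by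
  refine eLpNorm_congr_ae ?_
  filter_upwards [Lp.coeFn_sub (hf.toLp f) u, hf.coeFn_toLp] with x h1 h2
  rw [h1, Pi.sub_apply, h2]

theorem normOn_sub_sub_eq_eLpNorm {f : Space d → ℝ} (hf : MemLp f 1 (volume.restrict Ω))
    (p : ℝ≥0∞) (u v : L1 Ω) : normOn Ω p (fun x ↦ f x - u x - v x)
      = eLpNorm (hf.toLp f - u - v : L1 Ω) p (volume.restrict Ω) := by
  refine eLpNorm_congr_ae ?_
  filter_upwards [Lp.coeFn_sub (hf.toLp f - u) v, Lp.coeFn_sub (hf.toLp f) u, hf.coeFn_toLp]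
    with x h1 h2 h3
  rw [h1, Pi.sub_apply, h2, Pi.sub_apply, h3]

theorem enorm_le_eLpNorm_two_mul (g : L1 Ω) :
    ‖g‖ₑ ≤ eLpNorm g 2 (volume.restrict Ω) * volume Ω ^ (1 / 2 : ℝ) := by
  rw [Lp.enorm_def]
  refine (eLpNorm_le_eLpNorm_mul_rpow_measure_univ (p := 1) (q := 2) (by norm_num)
    (Lp.aestronglyMeasurable g)).trans_eq ?_
  rw [Measure.restrict_apply_univ]
  norm_num

/-! ### The two limits and the uniqueness of the `L²` minimiser -/

theorem norm_le_div_of_mul_enorm_le {v : L1 Ω} {lam : ℝ≥0} (hlam : 0 < lam) {B : ℝ≥0∞}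
    (hB : B ≠ ∞) (h : lam * normOn Ω 1 v ≤ B) : ‖v‖ ≤ B.toReal / lam := by
  rw [← enorm_eq_normOn_one] at h
  have h1 := ENNReal.toReal_mono hB h
  rw [ENNReal.toReal_mul, ENNReal.coe_toReal, toReal_enorm] at h1
  rwa [le_div_iff₀' (by exact_mod_cast hlam)]

theorem norm_sq_le_div_of_mul_eLpNorm_sq_le (hΩ : volume Ω ≠ ∞) {g : L1 Ω} {lam : ℝ≥0}
    (hlam : 0 < lam) {B : ℝ≥0∞} (hB : B ≠ ∞)
    (h : lam / 2 * eLpNorm g 2 (volume.restrict Ω) ^ 2 ≤ B) :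
    ‖g‖ ^ 2 ≤ 2 * B.toReal * volume.real Ω / lam := by
  have h1 : lam / 2 * ‖g‖ₑ ^ 2 ≤ B * volume Ω := by
    calc lam / 2 * ‖g‖ₑ ^ 2
        ≤ lam / 2 * (eLpNorm g 2 (volume.restrict Ω) * volume Ω ^ (1 / 2 : ℝ)) ^ 2 := by
          gcongr
          exact enorm_le_eLpNorm_two_mul g
      _ = lam / 2 * eLpNorm g 2 (volume.restrict Ω) ^ 2 * volume Ω := by
          rw [mul_pow, ← mul_assoc, ← ENNReal.rpow_mul_natCast]
          norm_num
      _ ≤ B * volume Ω := by gcongr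
  have h2 := ENNReal.toReal_mono (by finiteness) h1
  rw [ENNReal.toReal_mul, ENNReal.toReal_div, ENNReal.coe_toReal, ENNReal.toReal_pow, toReal_enorm,
    ENNReal.toReal_mul, ENNReal.toReal_ofNat, ← measureReal_def] at h2
  rw [le_div_iff₀ (by exact_mod_cast hlam)]
  linarith

theorem tendsto_const_div_nnreal_atTop {lam : ℕ → ℝ≥0} (h : Tendsto lam atTop atTop) (C : ℝ) :
    Tendsto (fun n ↦ C / (lam n : ℝ)) atTop (𝓝 0) :=
  Tendsto.const_div_atTop (NNReal.tendsto_coe_atTop.2 h) C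

/-- For fixed `λ₁` and `λ₂ → ∞` the residuals `f - u n - v n` tend to `0` in `L¹(Ω)`, so that
`v n → f - u'` whenever `u n → u'`. -/
theorem approximatesEnergy_energyL1 (hΩ : IsBoundedLipschitzDomain Ω) (hJ : IsRegulariser Ω J)
    {f : Space d → ℝ} (hf : MemLp f 1 (volume.restrict Ω)) {lam₁ : ℝ≥0} (h₁ : 0 < lam₁)
    {lam₂ : ℕ → ℝ≥0} (h₂ : ∀ n, 0 < lam₂ n) (hlim : Tendsto lam₂ atTop atTop)
    {u v : ℕ → L1 Ω} (huv : ∀ n, IsOptimalPair Ω J lam₁ (lam₂ n) f (u n) (v n)) :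
    ApproximatesEnergy Ω J (energyL1 Ω J lam₁ f) u
      fun n ↦ J (u n) + splitFidelity Ω lam₁ (lam₂ n) f (u n) (v n) := by
  set F : L1 Ω := hf.toLp f with hF
  have hvol : volume Ω ≠ ∞ := hΩ.isBounded.measure_lt_top.ne
  have hE : ∀ w : L1 Ω, energyL1 Ω J lam₁ f w = J w + lam₁ * ‖F - w‖ₑ := fun w ↦ by
    rw [energyL1, normOn_sub_eq_eLpNorm hf, ← Lp.enorm_def]
  have hopt : ∀ n, ∀ w ∈ BV Ω, J (u n) + splitFidelity Ω lam₁ (lam₂ n) f (u n) (v n)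
      ≤ energyL1 Ω J lam₁ f w := fun n w hw ↦ by
    -- the competitor for `v` is `f - w`
    refine ((huv n).2 w hw (F - w)).trans_eq ?_
    rw [splitFidelity, normOn_sub_sub_eq_eLpNorm hf, ← hF, sub_self, hE, enorm_eq_normOn_one,
      eLpNorm_congr_ae (Lp.coeFn_zero ℝ 1 _), eLpNorm_zero]
    simp
  set B := energyL1 Ω J lam₁ f 0 with hBdef
  have hB : B ≠ ∞ := by
    rw [hBdef, hE, hJ.map_zero]
    finiteness
  have hsplit : ∀ n, splitFidelity Ω lam₁ (lam₂ n) f (u n) (v n) ≤ B := fun n ↦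
    le_add_self.trans (hopt n 0 zero_mem_BV)
  have hv : ∀ n, ‖v n‖ ≤ B.toReal / lam₁ := fun n ↦
    norm_le_div_of_mul_enorm_le h₁ hB (le_self_add.trans (hsplit n))
  have hr : ∀ n, ‖F - u n - v n‖ ^ 2 ≤ 2 * B.toReal * volume.real Ω / lam₂ n := fun n ↦ by
    refine norm_sq_le_div_of_mul_eLpNorm_sq_le hvol (h₂ n) hB ?_
    rw [← normOn_sub_sub_eq_eLpNorm hf]
    exact le_add_self.trans (hsplit n)
  have hr0 : Tendsto (fun n ↦ F - u n - v n) atTop (𝓝 0) := by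
    rw [tendsto_zero_iff_norm_tendsto_zero]
    have h := squeeze_zero (fun n ↦ sq_nonneg _) hr (tendsto_const_div_nnreal_atTop hlim _)
    simpa using h.sqrt
  refine ⟨fun n ↦ (huv n).1, fun n ↦ le_self_add, hopt, hB, ?_, fun σ u' hσ hu c hc ↦ ?_⟩
  · obtain ⟨R, hR⟩ := (Metric.isBounded_range_of_tendsto _ hr0).exists_norm_le
    refine ⟨‖F‖ + B.toReal / lam₁ + R, fun n ↦ ?_⟩
    have h1 : u n = F - v n - (F - u n - v n) := by abel
    rw [h1]
    refine (norm_sub_le _ _).trans (add_le_add ((norm_sub_le _ _).trans ?_) (hR _ ⟨n, rfl⟩))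
    exact add_le_add le_rfl (hv n)
  · have hvlim : Tendsto (v ∘ σ) atTop (𝓝 (F - u')) := by
      have := (tendsto_const_nhds (x := F)).sub (hu.add (hr0.comp hσ))
      rw [add_zero] at this
      refine this.congr fun k ↦ ?_
      simp only [Function.comp_apply]
      abel
    have hlsc : LowerSemicontinuous fun p : L1 Ω × L1 Ω ↦ J p.1 + lam₁ * ‖p.2‖ₑ := by
      refine (hJ.lsc.comp continuous_fst).add (Continuous.lowerSemicontinuous ?_)
      exact (ENNReal.continuous_const_mul ENNReal.coe_ne_top).comp
        (continuous_enorm.comp continuous_snd)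
    rw [hE] at hc
    filter_upwards [(hu.prodMk_nhds hvlim).eventually (hlsc (u', F - u') c hc)] with k hk
    refine hk.trans_le (add_le_add le_rfl ?_)
    simp only [Function.comp_apply]
    rw [enorm_eq_normOn_one]
    exact le_self_add

/-- For fixed `λ₂` and `λ₁ → ∞` the components `v n` tend to `0` in `L¹(Ω)`. -/
theorem approximatesEnergy_energyL2 (hΩ : IsBoundedLipschitzDomain Ω) (hJ : IsRegulariser Ω J)
    {f : Space d → ℝ} (hf : MemLp f 2 (volume.restrict Ω)) {lam₂ : ℝ≥0} (h₂ : 0 < lam₂)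
    {lam₁ : ℕ → ℝ≥0} (h₁ : ∀ n, 0 < lam₁ n) (hlim : Tendsto lam₁ atTop atTop)
    {u v : ℕ → L1 Ω} (huv : ∀ n, IsOptimalPair Ω J (lam₁ n) lam₂ f (u n) (v n)) :
    ApproximatesEnergy Ω J (energyL2 Ω J lam₂ f) u
      fun n ↦ J (u n) + splitFidelity Ω (lam₁ n) lam₂ f (u n) (v n) := by
  have hvol : volume Ω ≠ ∞ := hΩ.isBounded.measure_lt_top.ne
  have : IsFiniteMeasure ((volume : Measure (Space d)).restrict Ω) :=
    isFiniteMeasure_restrict.2 hvol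
  have hf1 : MemLp f 1 (volume.restrict Ω) := hf.mono_exponent (by norm_num)
  set F : L1 Ω := hf1.toLp f with hF
  have hE : ∀ w : L1 Ω, energyL2 Ω J lam₂ f w
      = J w + lam₂ / 2 * eLpNorm (F - w : L1 Ω) 2 (volume.restrict Ω) ^ 2 := fun w ↦ by
    rw [energyL2, normOn_sub_eq_eLpNorm hf1]
  have hopt : ∀ n, ∀ w ∈ BV Ω, J (u n) + splitFidelity Ω (lam₁ n) lam₂ f (u n) (v n)
      ≤ energyL2 Ω J lam₂ f w := fun n w hw ↦ by
    refine ((huv n).2 w hw 0).trans_eq ?_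
    rw [splitFidelity, normOn_sub_sub_eq_eLpNorm hf1, hE, sub_zero, ← enorm_eq_normOn_one]
    simp [hF]
  set B := energyL2 Ω J lam₂ f 0 with hBdef
  have hB : B ≠ ∞ := by
    have h0 : eLpNorm (F - 0 : L1 Ω) 2 (volume.restrict Ω) ≠ ∞ := by
      rw [sub_zero, eLpNorm_congr_ae hf1.coeFn_toLp]
      exact hf.eLpNorm_ne_top
    rw [hBdef, hE, hJ.map_zero, zero_add]
    exact ENNReal.mul_ne_top (ENNReal.div_ne_top ENNReal.coe_ne_top two_ne_zero)
      (ENNReal.pow_ne_top h0)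
  have hsplit : ∀ n, splitFidelity Ω (lam₁ n) lam₂ f (u n) (v n) ≤ B := fun n ↦
    le_add_self.trans (hopt n 0 zero_mem_BV)
  have hv : ∀ n, ‖v n‖ ≤ B.toReal / lam₁ n := fun n ↦
    norm_le_div_of_mul_enorm_le (h₁ n) hB (le_self_add.trans (hsplit n))
  have hr : ∀ n, ‖F - u n - v n‖ ^ 2 ≤ 2 * B.toReal * volume.real Ω / lam₂ := fun n ↦ by
    refine norm_sq_le_div_of_mul_eLpNorm_sq_le hvol h₂ hB ?_
    rw [← normOn_sub_sub_eq_eLpNorm hf1]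
    exact le_add_self.trans (hsplit n)
  have hv0 : Tendsto v atTop (𝓝 0) :=
    squeeze_zero_norm hv (tendsto_const_div_nnreal_atTop hlim _)
  refine ⟨fun n ↦ (huv n).1, fun n ↦ le_self_add, hopt, hB, ?_, fun σ u' hσ hu c hc ↦ ?_⟩
  · obtain ⟨R, hR⟩ := (Metric.isBounded_range_of_tendsto _ hv0).exists_norm_le
    refine ⟨‖F‖ + R + √(2 * B.toReal * volume.real Ω / lam₂), fun n ↦ ?_⟩
    have h1 : u n = F - v n - (F - u n - v n) := by abel
    rw [h1]
    refine (norm_sub_le _ _).trans (add_le_add ((norm_sub_le _ _).trans ?_)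
      (Real.le_sqrt_of_sq_le (hr n)))
    exact add_le_add le_rfl (hR _ ⟨n, rfl⟩)
  · have hlsc : LowerSemicontinuous fun p : L1 Ω × L1 Ω ↦
        J p.1 + lam₂ / 2 * eLpNorm (F - p.1 - p.2 : L1 Ω) 2 (volume.restrict Ω) ^ 2 := by
      refine (hJ.lsc.comp continuous_fst).add ?_
      have h1 : LowerSemicontinuous fun p : L1 Ω × L1 Ω ↦
          eLpNorm (F - p.1 - p.2 : L1 Ω) 2 (volume.restrict Ω) :=
        (lowerSemicontinuous_eLpNorm_coeFn 2).comp
          ((continuous_const.sub continuous_fst).sub continuous_snd)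
      refine Continuous.comp_lowerSemicontinuous (g := fun t : ℝ≥0∞ ↦ lam₂ / 2 * t ^ 2)
        ((ENNReal.continuous_const_mul (by finiteness)).comp (ENNReal.continuous_pow 2)) h1
        fun a b hab ↦ ?_
      simp only
      gcongr
    rw [hE] at hc
    have hlim := hu.prodMk_nhds (hv0.comp hσ)
    filter_upwards [hlim.eventually (hlsc (u', 0) c (by simpa only [sub_zero] using hc))]
      with k hk
    refine hk.trans_le (add_le_add le_rfl ?_)
    simp only [Function.comp_apply]
    rw [← normOn_sub_sub_eq_eLpNorm hf1]
    exact le_add_self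

theorem eLpNorm_two_sq {X : Type*} [MeasurableSpace X] {μ : Measure X} (g : X → ℝ) :
    eLpNorm g 2 μ ^ 2 = ∫⁻ x, ‖g x‖ₑ ^ 2 ∂μ := by
  have := eLpNorm_nnreal_pow_eq_lintegral (f := g) (μ := μ) (p := 2) two_ne_zero
  simpa using this

/-- The parallelogram identity, in the form that gives strict convexity of the squared norm. -/
theorem eLpNorm_sq_midpoint_add {X : Type*} [MeasurableSpace X] {μ : Measure X} {a b : X → ℝ}
    (ha : AEStronglyMeasurable a μ) (hb : AEStronglyMeasurable b μ) :
    eLpNorm (fun x ↦ 2⁻¹ * (a x + b x)) 2 μ ^ 2 + eLpNorm (fun x ↦ 2⁻¹ * (a x - b x)) 2 μ ^ 2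
      = 2⁻¹ * eLpNorm a 2 μ ^ 2 + 2⁻¹ * eLpNorm b 2 μ ^ 2 := by
  have hsq : ∀ t : ℝ, ‖t‖ₑ ^ 2 = ENNReal.ofReal (t ^ 2) := fun t ↦ by
    rw [← ofReal_norm, ← ENNReal.ofReal_pow (norm_nonneg _), Real.norm_eq_abs, sq_abs]
  have h2 : (2⁻¹ : ℝ≥0∞) = ENNReal.ofReal 2⁻¹ := by
    rw [ENNReal.ofReal_inv_of_pos two_pos, ENNReal.ofReal_ofNat]
  simp only [eLpNorm_two_sq]
  have ha2 : AEMeasurable (fun x ↦ ‖a x‖ₑ ^ 2) μ := ha.enorm.pow_const 2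
  have hb2 : AEMeasurable (fun x ↦ ‖b x‖ₑ ^ 2) μ := hb.enorm.pow_const 2
  have hab : AEMeasurable (fun x ↦ ‖2⁻¹ * (a x + b x)‖ₑ ^ 2) μ :=
    ((ha.add hb).const_mul 2⁻¹).enorm.pow_const 2
  rw [← lintegral_add_left' hab, ← lintegral_const_mul'' _ ha2, ← lintegral_const_mul'' _ hb2,
    ← lintegral_add_left' (ha2.const_mul _)]
  refine lintegral_congr fun x ↦ ?_
  rw [hsq, hsq, hsq, hsq, h2, ← ENNReal.ofReal_mul (by positivity),
    ← ENNReal.ofReal_mul (by positivity), ← ENNReal.ofReal_add (by positivity) (by positivity),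
    ← ENNReal.ofReal_add (by positivity) (by positivity)]
  congr 1
  ring

/-- Strict convexity of the squared `L²` norm makes the minimiser of the `L²` energy unique. -/
theorem eq_of_isMinimiserBV_energyL2 (hJ : IsRegulariser Ω J) {f : Space d → ℝ}
    (hf : MemLp f 2 (volume.restrict Ω)) {lam : ℝ≥0} (hlam : 0 < lam) {u w : L1 Ω}
    (hu : IsMinimiserBV Ω (energyL2 Ω J lam f) u) (hw : IsMinimiserBV Ω (energyL2 Ω J lam f) w) :
    u = w := by
  set N : (Space d → ℝ) → ℝ≥0∞ := fun g ↦ eLpNorm g 2 (volume.restrict Ω) ^ 2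
  have hN : ∀ g h, g =ᵐ[volume.restrict Ω] h → N g = N h := fun g h hgh ↦
    congrArg (· ^ 2) (eLpNorm_congr_ae hgh)
  have hE : ∀ z, energyL2 Ω J lam f z = J z + lam / 2 * N fun x ↦ f x - z x := fun z ↦ rfl
  have hlam2 : (lam / 2 : ℝ≥0∞) ≠ 0 :=
    ENNReal.div_ne_zero.2 ⟨by simpa using hlam.ne', by simp⟩
  have hlam2' : (lam / 2 : ℝ≥0∞) ≠ ∞ := by finiteness
  set z : L1 Ω := (2⁻¹ : ℝ) • (u + w) with hz
  obtain ⟨⟨m, hm⟩, humin⟩ := hu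
  obtain ⟨⟨n, hn⟩, hwmin⟩ := hw
  have hzBV : z ∈ BV Ω := ⟨_, (hm.add hn).smul 2⁻¹⟩
  have huw : energyL2 Ω J lam f u = energyL2 Ω J lam f w :=
    le_antisymm (humin w ⟨n, hn⟩) (hwmin u ⟨m, hm⟩)
  have hfin : energyL2 Ω J lam f u ≠ ∞ := by
    refine ne_top_of_le_ne_top ?_ (humin 0 zero_mem_BV)
    have h0 : N (fun x ↦ f x - (0 : L1 Ω) x) = N f := by
      refine hN _ _ ?_
      filter_upwards [Lp.coeFn_zero ℝ 1 ((volume : Measure (Space d)).restrict Ω)] with x hx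
      rw [hx, Pi.zero_apply, sub_zero]
    rw [hE, h0, hJ.map_zero, zero_add]
    exact ENNReal.mul_ne_top hlam2' (ENNReal.pow_ne_top hf.eLpNorm_ne_top)
  have hNz : N (fun x ↦ f x - z x) = N fun x ↦ 2⁻¹ * ((f x - u x) + (f x - w x)) := by
    refine hN _ _ ?_
    filter_upwards [Lp.coeFn_smul (2⁻¹ : ℝ) (u + w), Lp.coeFn_add u w] with x h1 h2
    rw [hz, h1, Pi.smul_apply, h2, Pi.add_apply, smul_eq_mul]
    ring
  have hpar := eLpNorm_sq_midpoint_add (hf.1.sub (Lp.aestronglyMeasurable u))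
    (hf.1.sub (Lp.aestronglyMeasurable w))
  simp only [Pi.sub_apply] at hpar
  set D := N fun x ↦ 2⁻¹ * ((f x - u x) - (f x - w x)) with hD
  have hhalf : ((2⁻¹ : ℝ≥0) : ℝ≥0∞) = 2⁻¹ := by simp
  have hJz : J z ≤ 2⁻¹ * J u + 2⁻¹ * J w := by
    have := hJ.convex.2 (mem_univ u) (mem_univ w)
      (show (0 : ℝ≥0) ≤ 2⁻¹ from zero_le) (show (0 : ℝ≥0) ≤ 2⁻¹ from zero_le)
      (by rw [← two_mul, mul_inv_cancel₀ two_ne_zero])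
    simp only [ENNReal.smul_def, smul_eq_mul, hhalf] at this
    refine le_of_eq_of_le (congrArg J ?_) this
    rw [hz, smul_add]
    rfl
  have hkey : energyL2 Ω J lam f z + lam / 2 * D ≤ energyL2 Ω J lam f u := by
    calc energyL2 Ω J lam f z + lam / 2 * D
        = J z + lam / 2 * (N (fun x ↦ 2⁻¹ * ((f x - u x) + (f x - w x))) + D) := by
          rw [hE, hNz, mul_add, add_assoc]
      _ ≤ (2⁻¹ * J u + 2⁻¹ * J w) + lam / 2 * (2⁻¹ * N (fun x ↦ f x - u x)
            + 2⁻¹ * N (fun x ↦ f x - w x)) := add_le_add hJz (mul_le_mul_right hpar.le _)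
      _ = 2⁻¹ * energyL2 Ω J lam f u + 2⁻¹ * energyL2 Ω J lam f w := by
          rw [hE, hE]
          ring
      _ = energyL2 Ω J lam f u := by
          rw [← huw, ← add_mul, ENNReal.inv_two_add_inv_two, one_mul]
  have hD0 : D = 0 := by
    have h1 : energyL2 Ω J lam f u + lam / 2 * D ≤ energyL2 Ω J lam f u + 0 := by
      rw [add_zero]
      exact (add_le_add (humin z hzBV) le_rfl).trans hkey
    have h2 := (ENNReal.add_le_add_iff_left hfin).1 h1
    exact (mul_eq_zero.1 (le_antisymm h2 zero_le)).resolve_left hlam2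
  have h3 : eLpNorm (fun x ↦ 2⁻¹ * ((f x - u x) - (f x - w x))) 2 (volume.restrict Ω) = 0 :=
    pow_eq_zero_iff two_ne_zero |>.1 hD0
  have h4 : AEStronglyMeasurable (fun x ↦ 2⁻¹ * ((f x - u x) - (f x - w x)))
      (volume.restrict Ω) := ((hf.1.sub (Lp.aestronglyMeasurable u)).sub
    (hf.1.sub (Lp.aestronglyMeasurable w))).const_mul 2⁻¹
  rw [eLpNorm_eq_zero_iff h4 two_ne_zero] at h3
  refine Lp.ext ?_
  filter_upwards [h3] with x hx
  simp only [Pi.zero_apply] at hx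
  linarith

end MixedNoise

end

open MixedNoise
theorem corollary2p4 {d : ℕ} (hd : 0 < d) (Ω : Set (Space d))
    (hΩ : IsBoundedLipschitzDomain Ω)
    (J : L1 Ω → ℝ≥0∞) (hJ : IsRegulariser Ω J) :
    -- Part (i): `λ₁` is fixed and `λ₂ → ∞`.
    (∀ (f : Space d → ℝ) (_ : MemLp f 1 (volume.restrict Ω))
        (lam₁ : ℝ≥0) (_ : 0 < lam₁)
        (lam₂ : ℕ → ℝ≥0) (_ : ∀ n, 0 < lam₂ n) (_ : Tendsto lam₂ atTop atTop)
        (u : ℕ → L1 Ω)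
        (_ : ∀ n, ∃ v, IsOptimalPair Ω J lam₁ (lam₂ n) f (u n) v),
      (∀ a : ℕ → ℕ, StrictMono a → ∃ (b : ℕ → ℕ) (u' : L1 Ω), StrictMono b ∧
        TendstoWeakStarBV Ω (fun k => u (a (b k))) u' ∧
        IsMinimiserBV Ω (energyL1 Ω J lam₁ f) u') ∧
      (∀ u' : L1 Ω,
        IsMinimiserBV Ω (energyL1 Ω J lam₁ f) u' →
        (∀ w, IsMinimiserBV Ω (energyL1 Ω J lam₁ f) w → w = u') →
        TendstoWeakStarBV Ω u u' ∧
        Tendsto (fun n => J (u n) + icFidelity Ω lam₁ (lam₂ n) f (u n)) atTop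
          (𝓝 (energyL1 Ω J lam₁ f u')))) ∧
    -- Part (ii): `λ₂` is fixed and `λ₁ → ∞`.
    (∀ (f : Space d → ℝ) (_ : MemLp f 2 (volume.restrict Ω))
        (lam₂ : ℝ≥0) (_ : 0 < lam₂)
        (lam₁ : ℕ → ℝ≥0) (_ : ∀ n, 0 < lam₁ n) (_ : Tendsto lam₁ atTop atTop)
        (u : ℕ → L1 Ω)
        (_ : ∀ n, ∃ v, IsOptimalPair Ω J (lam₁ n) lam₂ f (u n) v),
      ∃ u' : L1 Ω,
        IsMinimiserBV Ω (energyL2 Ω J lam₂ f) u' ∧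
        (∀ w, IsMinimiserBV Ω (energyL2 Ω J lam₂ f) w → w = u') ∧
        TendstoWeakStarBV Ω u u' ∧
        Tendsto (fun n => J (u n) + icFidelity Ω (lam₁ n) lam₂ f (u n)) atTop
          (𝓝 (energyL2 Ω J lam₂ f u'))) := by
  refine ⟨fun f hf lam₁ h₁ lam₂ h₂ hlim u hu ↦ ?_, fun f hf lam₂ h₂ lam₁ h₁ hlim u hu ↦ ?_⟩
  · choose v huv using hu
    have h := approximatesEnergy_energyL1 hΩ hJ hf h₁ h₂ hlim huv
    refine ⟨fun a ha ↦ ?_, fun u' hu' huniq ↦ ?_⟩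
    · obtain ⟨b, u', hb, hlim⟩ := h.exists_subseq hJ hΩ a
      exact ⟨b, u', hb, h.tendstoWeakStarBV hJ hΩ.isOpen (σ := fun k ↦ a (b k)) hlim,
        h.isMinimiserBV hJ hΩ.isOpen (ha.comp hb).tendsto_atTop hlim⟩
    · simp only [fun n ↦ (huv n).add_icFidelity]
      exact h.tendsto_of_unique hJ hΩ hu' huniq
  · choose v huv using hu
    have h := approximatesEnergy_energyL2 hΩ hJ hf h₂ h₁ hlim huv
    obtain ⟨b, u', hb, hlim⟩ := h.exists_subseq hJ hΩ id
    have hu' := h.isMinimiserBV hJ hΩ.isOpen hb.tendsto_atTop hlim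
    have huniq : ∀ w, IsMinimiserBV Ω (energyL2 Ω J lam₂ f) w → w = u' := fun w hw ↦
      eq_of_isMinimiserBV_energyL2 hJ hf h₂ hw hu'
    simp only [fun n ↦ (huv n).add_icFidelity]
    exact ⟨u', hu', huniq, h.tendsto_of_unique hJ hΩ hu' huniq⟩
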